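/- Let $d,p\ge 1$, $\Theta=[\theta_{\inf},\theta_{\sup}]^p$, and let $\theta_0$ satisfy $\theta_{\inf}<(\theta_0)_i<\theta_{\sup}$ for all $i$. Let $\{K_\theta,\theta\in\Theta\}$ be stationary covariance functions on $\mathbb{R}^d$ such that: * for every $t\in\mathbb{R}^d$, $\theta\mapsto K_\theta(t)$ is three times differentiable on $\Theta$, and for all $q\in\{0,\dots,3\}$ and $i_1,\dots,i_q\in\{1,\dots,p\}$ there is a finite constant $C_{i_1,\dots,i_q}$ with $\left|\frac{\partial}{\partial\theta_{i_1}}\cdots\frac{\partial}{\partial\theta_{i_q}}K_\theta(t)\right|\le \frac{C_{i_1,\dots,i_q}}{1+|t|^{d+1}}$ for all $\theta\in\Theta$, $t\in\mathbb{R}^d$, where $|\cdot|$ is the Euclidean norm; * with $\hat K_\theta(f)=(2\pi)^{-d}\int_{\mathbb{R}^d}K_\theta(t)e^{-\mathrm{i}f\cdot t}\,dt$, the function $\hat K_\theta$ is integrable and $K_\theta(t)=\int_{\mathbb{R}^d}\hat K_\theta(f)e^{\mathrm{i}f\cdot t}\,df$ for all $\theta\in\Theta$ and $t\in\mathbb{R}^d$,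 and $(f,\theta)\mapsto\hat K_\theta(f)$ is real-valued, continuous and positive on $\mathbb{R}^d\times\Theta$. Let $(v_i)_{i\ge1}$ be a sequence of points of $\{1,2,\dots\}^d$ with $\{v_i:1\le i\le N^d\}=\{1,\dots,N\}^d$ for every $N\ge1$, let $\epsilon\in[0,\frac12)$, and let $X_1,X_2,\dots$ be independent random vectors with common law $\mathcal{L}_X$, a symmetric probability distribution on $\mathbb{R}^d$ whose topological support $S_X$ is contained in $[-1,1]^d$ and which has a density with respect to Lebesgue measure that is positive on $S_X$. Let $R_\theta$ be the $n\times n$ random matrix with entries $(R_\theta)_{a,b}=K_\theta(v_a-v_b+\epsilon(X_a-X_b))$, and let $R=R_{\theta_0}$ and $\frac{\partial R}{\partial\theta_i}=\frac{\partial R_\theta}{\partial\theta_i}\big|_{\theta=\theta_0}$. Let $\Sigma_{ML}$ be the deterministic $p\times p$ matrix whose $(i,j)$ entry is the almost sure limit, as $n\to\infty$, of $$\frac1n\,\mathrm{Tr}\left(\frac12R^{-1}\frac{\partial R}{\partial\theta_i}R^{-1}\frac{\partial R}{\partial\theta_j}\right).$$ 1. Case $\epsilon=0$. If there is no $(\lambda_1,\dots,\lambda_p)\in\mathbb{R}^p\setminus\{0\}$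 such that $\sum_{k=1}^p\lambda_k\frac{\partial}{\partial\theta_k}K_{\theta_0}(v)=0$ for all $v\in\mathbb{Z}^d$, then $\Sigma_{ML}$ exists and is positive definite. 2. Case $\epsilon\ne0$. Let $C_{S_X}=\{t_1-t_2:t_1,t_2\in S_X\}$ and $D_\epsilon=\bigcup_{v\in\mathbb{Z}^d\setminus\{0\}}(v+\epsilon C_{S_X})$. If there is no $(\lambda_1,\dots,\lambda_p)\in\mathbb{R}^p\setminus\{0\}$ such that both $\sum_{k=1}^p\lambda_k\frac{\partial}{\partial\theta_k}K_{\theta_0}(t)=0$ for Lebesgue-almost every $t\in D_\epsilon$ and $\sum_{k=1}^p\lambda_k\frac{\partial}{\partial\theta_k}K_{\theta_0}(0)=0$, then $\Sigma_{ML}$ exists and is positive definite. -/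

import Mathlib

namespace PerturbedGrid

open MeasureTheory

noncomputable section

/-- The parameter set `Θ = [a, b]^p`. -/
def paramBox (p : ℕ) (a b : ℝ) : Set (Fin p → ℝ) :=
  Set.Icc (fun _ => a) (fun _ => b)

/-- The partial derivative `∂F/∂θ_i`, taken within `Θ` (so it is one-sided on the faces of the
box, and the usual partial derivative at interior points). -/
def partialWithin {p : ℕ} (Θ : Set (Fin p → ℝ)) (i : Fin p) (F : (Fin p → ℝ) → ℝ) :
    (Fin p → ℝ) → ℝ :=
  fun θ => lineDerivWithin ℝ F Θ θ (Pi.single i 1)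

/-- The iterated partial derivative `∂/∂θ_{i_1} ⋯ ∂/∂θ_{i_q} F` for the list `[i_1, …, i_q]`. -/
def iterPartialWithin {p : ℕ} (Θ : Set (Fin p → ℝ)) (I : List (Fin p))
    (F : (Fin p → ℝ) → ℝ) : (Fin p → ℝ) → ℝ :=
  I.foldr (partialWithin Θ) F

/-- The Fourier transform `(2π)^{-d} ∫ h(t) e^{-i f·t} dt`. -/
def fourierHat {d : ℕ} (h : EuclideanSpace ℝ (Fin d) → ℝ) (f : EuclideanSpace ℝ (Fin d)) : ℂ :=
  (1 / (2 * (Real.pi : ℂ)) ^ d) *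
    ∫ t : EuclideanSpace ℝ (Fin d), (h t : ℂ) * Complex.exp (-(Complex.I * (inner ℝ f t : ℝ)))

/-- `(s, t) ↦ k (s - t)` is a (stationary) covariance function on `ℝ^d`: it is symmetric and
positive semidefinite. -/
structure IsStationaryCovariance {d : ℕ} (k : EuclideanSpace ℝ (Fin d) → ℝ) : Prop where
  symm : ∀ t, k (-t) = k t
  nonneg : ∀ (m : ℕ) (x : Fin m → EuclideanSpace ℝ (Fin d)) (c : Fin m → ℝ),
    0 ≤ ∑ i, ∑ j, c i * c j * k (x i - x j)

/-- The standing condition on the parametric covariance model `{K_θ, θ ∈ Θ}`. Nothing is required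
of `K θ` for `θ ∉ Θ`. -/
structure IsRegularModel {d p : ℕ} (Θ : Set (Fin p → ℝ))
    (K : (Fin p → ℝ) → EuclideanSpace ℝ (Fin d) → ℝ) : Prop where
  /-- each `K_θ` is a stationary covariance function -/
  covariance : ∀ θ ∈ Θ, IsStationaryCovariance (K θ)
  /-- `θ ↦ K_θ(t)` is three times differentiable on `Θ`: its partial derivatives of order at most
  two are differentiable -/
  differentiable : ∀ I : List (Fin p), I.length ≤ 2 → ∀ t,
    DifferentiableOn ℝ (iterPartialWithin Θ I (fun θ => K θ t)) Θ
  /-- decay of all partial derivatives of order at most three, uniformly in `θ` -/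
  decay : ∀ I : List (Fin p), I.length ≤ 3 → ∃ C : ℝ, ∀ θ ∈ Θ, ∀ t,
    |iterPartialWithin Θ I (fun θ => K θ t) θ| ≤ C / (1 + ‖t‖ ^ (d + 1))
  /-- Fourier inversion -/
  integrable_hat : ∀ θ ∈ Θ, Integrable (fourierHat (K θ))
  inversion : ∀ θ ∈ Θ, ∀ t, (K θ t : ℂ) =
    ∫ f : EuclideanSpace ℝ (Fin d), fourierHat (K θ) f * Complex.exp (Complex.I * (inner ℝ f t : ℝ))
  /-- the Fourier transform is jointly continuous in `(f, θ)` -/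
  continuous_hat : ContinuousOn
    (fun z : EuclideanSpace ℝ (Fin d) × (Fin p → ℝ) => fourierHat (K z.2) z.1) (Set.univ ×ˢ Θ)
  /-- the Fourier transform is real and positive -/
  hat_real : ∀ θ ∈ Θ, ∀ f, (fourierHat (K θ) f).im = 0
  hat_pos : ∀ θ ∈ Θ, ∀ f, 0 < (fourierHat (K θ) f).re

/-- `v_1, v_2, …` (indexed from `0` here) enumerates the positive integer grid through the growing
cubes: `{v_i, 1 ≤ i ≤ N^d} = {1, …, N}^d` for every `N ≥ 1`. -/
def IsGridEnumeration {d : ℕ} (v : ℕ → Fin d → ℤ) : Prop :=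
  ∀ N : ℕ, 1 ≤ N → v '' {i | i < N ^ d} = {w | ∀ k, 1 ≤ w k ∧ w k ≤ (N : ℤ)}

/-- The assumptions on the law `L_X` of the perturbations: a symmetric probability distribution
with support `S_X ⊆ [-1,1]^d` and a probability density that is positive on `S_X`. -/
structure IsPerturbationLaw {d : ℕ} (L : Measure (EuclideanSpace ℝ (Fin d))) : Prop where
  prob : IsProbabilityMeasure L
  symm : L.map (fun x => -x) = L
  support_subset : ∀ x ∈ L.support, ∀ k, -1 ≤ x k ∧ x k ≤ 1
  density : ∃ g : EuclideanSpace ℝ (Fin d) → ℝ, Measurable g ∧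
    L = volume.withDensity (fun x => ENNReal.ofReal (g x)) ∧ ∀ x ∈ L.support, 0 < g x

/-- An integer vector as a point of `ℝ^d`. -/
def latticePoint {d : ℕ} (w : Fin d → ℤ) : EuclideanSpace ℝ (Fin d) :=
  WithLp.toLp 2 (fun k => (w k : ℝ))

/-- The `n × n` matrix `(R_θ)_{ij} = K_θ(v_i - v_j + ε (x_i - x_j))`. -/
def covMatrix {d p : ℕ} (K : (Fin p → ℝ) → EuclideanSpace ℝ (Fin d) → ℝ) (v : ℕ → Fin d → ℤ)
    (ε : ℝ) (x : ℕ → EuclideanSpace ℝ (Fin d)) (n : ℕ) (θ : Fin p → ℝ) :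
    Matrix (Fin n) (Fin n) ℝ :=
  Matrix.of fun i j => K θ (latticePoint (v i) - latticePoint (v j) + ε • (x i - x j))

/-- The entrywise partial derivative `∂R_θ/∂θ_i`. -/
def covMatrixDeriv {d p : ℕ} (Θ : Set (Fin p → ℝ))
    (K : (Fin p → ℝ) → EuclideanSpace ℝ (Fin d) → ℝ) (v : ℕ → Fin d → ℤ)
    (ε : ℝ) (x : ℕ → EuclideanSpace ℝ (Fin d)) (n : ℕ) (θ : Fin p → ℝ) (i : Fin p) :
    Matrix (Fin n) (Fin n) ℝ :=
  Matrix.of fun a b => partialWithin Θ i (fun θ' => covMatrix K v ε x n θ' a b) θ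

/-- `M_ML^{i,j} = ½ R⁻¹ (∂R/∂θ_i) R⁻¹ (∂R/∂θ_j)`, at the parameter `θ`. -/
def matrixML {d p : ℕ} (Θ : Set (Fin p → ℝ))
    (K : (Fin p → ℝ) → EuclideanSpace ℝ (Fin d) → ℝ) (v : ℕ → Fin d → ℤ)
    (ε : ℝ) (x : ℕ → EuclideanSpace ℝ (Fin d)) (n : ℕ) (θ : Fin p → ℝ) (i j : Fin p) :
    Matrix (Fin n) (Fin n) ℝ :=
  (1 / 2 : ℝ) • ((covMatrix K v ε x n θ)⁻¹ * covMatrixDeriv Θ K v ε x n θ i *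
    (covMatrix K v ε x n θ)⁻¹ * covMatrixDeriv Θ K v ε x n θ j)

/-- `S` is the matrix `Σ_ML`: each entry `S i j` is the almost sure limit of
`(1/n) Tr (M_ML^{i,j})`. There is at most one such matrix. -/
def IsSigmaML {d p : ℕ} (Θ : Set (Fin p → ℝ))
    (K : (Fin p → ℝ) → EuclideanSpace ℝ (Fin d) → ℝ) (v : ℕ → Fin d → ℤ) (ε : ℝ)
    {Ω : Type*} [MeasurableSpace Ω] (P : Measure Ω) (X : ℕ → Ω → EuclideanSpace ℝ (Fin d))
    (θ₀ : Fin p → ℝ) (S : Matrix (Fin p) (Fin p) ℝ) : Prop :=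
  ∀ i j, ∀ᵐ ω ∂P, Filter.Tendsto
    (fun n : ℕ => (1 / (n : ℝ)) * (matrixML Θ K v ε (fun m => X m ω) n θ₀ i j).trace)
    Filter.atTop (nhds (S i j))

/-- `D_ε = ⋃_{v ∈ ℤ^d \ {0}} (v + ε C_S)`, where `C_S = {t₁ - t₂ : t₁, t₂ ∈ S}`. -/
def lagSet {d : ℕ} (S : Set (EuclideanSpace ℝ (Fin d))) (ε : ℝ) :
    Set (EuclideanSpace ℝ (Fin d)) :=
  {t | ∃ w : Fin d → ℤ, w ≠ 0 ∧ ∃ t₁ ∈ S, ∃ t₂ ∈ S, t = latticePoint w + ε • (t₁ - t₂)}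

/-- The directional derivative `∑_k λ_k ∂K_θ/∂θ_k (t)`. -/
def dirDeriv {d p : ℕ} (Θ : Set (Fin p → ℝ))
    (K : (Fin p → ℝ) → EuclideanSpace ℝ (Fin d) → ℝ) (θ : Fin p → ℝ) (lam : Fin p → ℝ)
    (t : EuclideanSpace ℝ (Fin d)) : ℝ :=
  ∑ k, lam k * partialWithin Θ k (fun θ' => K θ' t) θ

end

end PerturbedGrid

/-!
A positive continuous spectral density dominates a dilated bump function, whose Fourier transform
decays fast, so the covariance matrices of `K_θ` on separated configurations are bounded below by
one constant `c > 0`, whatever the perturbations and the number of points. Since all kernels are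
summable on the lattice, a matrix `A` among `R`, `∂R/∂θ_i` almost commutes with multiplication by
the cut-off `χ = min 1 (‖· - a‖ / ρ)`, and because `R ≥ c` so does `R⁻¹`. Applying the four factors
of `R⁻¹ A R⁻¹ B` to a basis vector at `a` one after the other, the result stays concentrated where
`χ` is small; hence a diagonal entry at `a` is, up to an error vanishing as `ρ → ∞`, the same
function of the perturbations in the lattice box of radius `ρ` about `a`. These local functions are
identically distributed and locally dependent, and boundary sites have density zero, so the
normalized traces obey a law of large numbers.

For `A = ∑ λ_i ∂R/∂θ_i` the trace of `R⁻¹ A R⁻¹ A` is at least a constant times the squared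
Frobenius norm of `A`, and keeping only one lag shows that its normalized limit is at least a
multiple of the mean of `(∑ λ_i ∂K/∂θ_i)²` over perturbations of that lag. This is positive when
`∑ λ_i ∂K/∂θ_i`, which is continuous, does not vanish at some lag in `D_ε ∪ {0}`.
-/

namespace PerturbedGrid

open Matrix MeasureTheory ProbabilityTheory Filter Topology WithLp
open scoped MatrixOrder Matrix.Norms.L2Operator

/-! ### Operator norms and coercive matrices -/

section OperatorNorm

variable {ι κ : Type*} [Fintype ι] [Fintype κ]

lemma norm_mulVec_le [DecidableEq ι] (M : Matrix κ ι ℝ) (x : ι → ℝ) :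
    ‖toLp 2 (M *ᵥ x)‖ ≤ ‖M‖ * ‖toLp 2 x‖ :=
  l2_opNorm_mulVec M (toLp 2 x)

lemma norm_toLp_sq (x : ι → ℝ) : ‖toLp 2 x‖ ^ 2 = ∑ i, x i ^ 2 := by
  simp [EuclideanSpace.norm_sq_eq]

lemma dotProduct_self_eq_norm_sq (x : ι → ℝ) : x ⬝ᵥ x = ‖toLp 2 x‖ ^ 2 := by
  rw [norm_toLp_sq, dotProduct]
  simp only [sq]

lemma abs_dotProduct_le_norm (x y : ι → ℝ) : |x ⬝ᵥ y| ≤ ‖toLp 2 x‖ * ‖toLp 2 y‖ := by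
  have h := abs_real_inner_le_norm (toLp 2 y) (toLp 2 x)
  rwa [EuclideanSpace.inner_toLp_toLp, star_trivial, mul_comm] at h

lemma norm_toLp_comp_le {e : κ → ι} (he : e.Injective) (x : ι → ℝ) :
    ‖toLp 2 (x ∘ e)‖ ≤ ‖toLp 2 x‖ := by
  classical
  refine le_of_sq_le_sq ?_ (norm_nonneg _)
  simp only [norm_toLp_sq, Function.comp_apply]
  rw [← Finset.sum_image (f := fun i => x i ^ 2) he.injOn]
  exact Finset.sum_le_sum_of_subset_of_nonneg (Finset.subset_univ _) fun _ _ _ => sq_nonneg _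

lemma norm_toLp_extend_zero {e : κ → ι} (he : e.Injective) (x : κ → ℝ) :
    ‖toLp 2 (Function.extend e x 0)‖ = ‖toLp 2 x‖ := by
  refine (sq_eq_sq₀ (norm_nonneg _) (norm_nonneg _)).1 ?_
  rw [norm_toLp_sq, norm_toLp_sq]
  refine (Fintype.sum_of_injective e he _ _ (fun i hi => ?_) fun k => ?_).symm
  · rw [Function.extend_apply' _ _ _ hi, Pi.zero_apply, sq, zero_mul]
  · rw [he.extend_apply]

lemma submatrix_mulVec_eq_mulVec_extend {e : κ → ι} (he : e.Injective) (M : Matrix ι ι ℝ)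
    (x : κ → ℝ) : M.submatrix e e *ᵥ x = (M *ᵥ Function.extend e x 0) ∘ e := by
  funext k
  refine Fintype.sum_of_injective e he _ _ (fun i hi => ?_) fun j => ?_
  · rw [Function.extend_apply' _ _ _ hi, Pi.zero_apply, mul_zero]
  · simp only [submatrix_apply, he.extend_apply]

variable [DecidableEq ι]

lemma l2_opNorm_le_of_forall {M : Matrix κ ι ℝ} {W : ℝ} (hW : 0 ≤ W)
    (h : ∀ x, ‖toLp 2 (M *ᵥ x)‖ ≤ W * ‖toLp 2 x‖) : ‖M‖ ≤ W := by
  rw [l2_opNorm_def]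
  exact ContinuousLinearMap.opNorm_le_bound _ hW fun x => h (ofLp x)

lemma l2_opNorm_submatrix_le [DecidableEq κ] {e : κ → ι} (he : e.Injective) (M : Matrix ι ι ℝ) :
    ‖M.submatrix e e‖ ≤ ‖M‖ := by
  refine l2_opNorm_le_of_forall (norm_nonneg _) fun x => ?_
  rw [submatrix_mulVec_eq_mulVec_extend he, ← norm_toLp_extend_zero he x]
  exact (norm_toLp_comp_le he _).trans (norm_mulVec_le _ _)

lemma l2_opNorm_le_of_sum_abs_le {M : Matrix κ ι ℝ} {W : ℝ} (hW : 0 ≤ W)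
    (hrow : ∀ i, ∑ j, |M i j| ≤ W) (hcol : ∀ j, ∑ i, |M i j| ≤ W) : ‖M‖ ≤ W := by
  refine l2_opNorm_le_of_forall hW fun x => le_of_sq_le_sq ?_ (by positivity)
  have hrow_sq (i : κ) : (M *ᵥ x) i ^ 2 ≤ W * ∑ j, |M i j| * x j ^ 2 := by
    refine (Finset.sum_sq_le_sum_mul_sum_of_sq_le_mul Finset.univ (f := fun j => |M i j|)
      (g := fun j => |M i j| * x j ^ 2) (fun _ _ => abs_nonneg _) (fun _ _ => by positivity)
      fun j _ => le_of_eq ?_).trans (mul_le_mul_of_nonneg_right (hrow i) (by positivity))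
    rw [mul_pow, ← sq_abs (M i j)]
    ring
  calc ‖toLp 2 (M *ᵥ x)‖ ^ 2 = ∑ i, (M *ᵥ x) i ^ 2 := norm_toLp_sq _
    _ ≤ ∑ i, W * ∑ j, |M i j| * x j ^ 2 := Finset.sum_le_sum fun i _ => hrow_sq i
    _ = W * ∑ j, (∑ i, |M i j|) * x j ^ 2 := by
        rw [← Finset.mul_sum, Finset.sum_comm]
        simp only [Finset.sum_mul]
    _ ≤ W * ∑ j, W * x j ^ 2 := by gcongr with j; exact hcol j
    _ = (W * ‖toLp 2 x‖) ^ 2 := by rw [← Finset.mul_sum, mul_pow, norm_toLp_sq]; ring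

lemma l2_opNorm_le_tsum {G : Type*} [AddGroup G] {m : G → ℝ} (hm₀ : ∀ w, 0 ≤ m w)
    (hm : Summable m) {u : ι → G} (hu : u.Injective) {M : Matrix ι ι ℝ}
    (hM : ∀ i j, |M i j| ≤ m (u i - u j)) : ‖M‖ ≤ ∑' w, m w := by
  classical
  have sum_le_tsum (f : ι → G) (hf : f.Injective) : ∑ j, m (f j) ≤ ∑' w, m w := by
    rw [← Finset.sum_image (f := m) hf.injOn]
    exact hm.sum_le_tsum _ fun _ _ => hm₀ _
  exact l2_opNorm_le_of_sum_abs_le (tsum_nonneg hm₀)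
    (fun i => (Finset.sum_le_sum fun j _ => hM i j).trans <|
      sum_le_tsum (fun j => u i - u j) (sub_right_injective.comp hu))
    (fun j => (Finset.sum_le_sum fun i _ => hM i j).trans <|
      sum_le_tsum (fun i => u i - u j) (sub_left_injective.comp hu))

end OperatorNorm

section Coercive

variable {ι κ : Type*} [DecidableEq ι] {c W : ℝ} {R : Matrix ι ι ℝ}

lemma posDef_of_smul_one_le (hc : 0 < c) (hR : c • 1 ≤ R) : R.PosDef := by
  simpa using PosDef.posSemidef_add (le_iff.1 hR) (PosDef.one.smul hc)

lemma smul_one_le_submatrix [DecidableEq κ] {e : κ → ι} (he : e.Injective)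
    (hR : c • 1 ≤ R) : c • 1 ≤ R.submatrix e e := by
  simpa [le_iff, submatrix_sub, submatrix_smul, submatrix_one e he] using
    (le_iff.1 hR).submatrix e

variable [Fintype ι]

omit [DecidableEq ι] in
lemma trace_mul_nonneg {P Q : Matrix ι ι ℝ} (hP : P.PosSemidef) (hQ : Q.PosSemidef) :
    0 ≤ (P * Q).trace := by
  obtain ⟨n, v, rfl⟩ := posSemidef_iff_eq_sum_vecMulVec.1 hP
  rw [Matrix.sum_mul, trace_sum]
  refine Finset.sum_nonneg fun i _ => ?_
  rw [vecMulVec_mul, trace_vecMulVec, dotProduct_comm, ← dotProduct_mulVec]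
  exact hQ.dotProduct_mulVec_nonneg (v i)

lemma smul_one_le_iff :
    c • 1 ≤ R ↔ R.IsHermitian ∧ ∀ x, c * ‖toLp 2 x‖ ^ 2 ≤ x ⬝ᵥ R *ᵥ x := by
  have hHerm : (R - c • 1).IsHermitian ↔ R.IsHermitian := by
    have hone : (c • (1 : Matrix ι ι ℝ)).IsHermitian := by simp [IsHermitian]
    exact ⟨fun h => by simpa using h.add hone, fun h => h.sub hone⟩
  rw [le_iff, posSemidef_iff_dotProduct_mulVec, hHerm]
  simp [sub_mulVec, smul_mulVec, dotProduct_sub, dotProduct_self_eq_norm_sq]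

lemma mul_norm_le_norm_mulVec (hR : c • 1 ≤ R) (x : ι → ℝ) :
    c * ‖toLp 2 x‖ ≤ ‖toLp 2 (R *ᵥ x)‖ := by
  rcases (norm_nonneg (toLp 2 x)).eq_or_lt with h | h
  · rw [← h, mul_zero]
    exact norm_nonneg _
  · have hquad := ((smul_one_le_iff.1 hR).2 x).trans
      ((le_abs_self _).trans (abs_dotProduct_le_norm x _))
    rw [sq, ← mul_assoc, mul_comm ‖toLp 2 x‖] at hquad
    exact le_of_mul_le_mul_right hquad h

lemma mulVec_inv_mulVec (hR : R.PosDef) (x : ι → ℝ) : R *ᵥ R⁻¹ *ᵥ x = x := by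
  rw [mulVec_mulVec, mul_nonsing_inv _ ((isUnit_iff_isUnit_det _).1 hR.isUnit), one_mulVec]

lemma inv_mulVec_mulVec (hR : R.PosDef) (x : ι → ℝ) : R⁻¹ *ᵥ R *ᵥ x = x := by
  rw [mulVec_mulVec, nonsing_inv_mul _ ((isUnit_iff_isUnit_det _).1 hR.isUnit), one_mulVec]

lemma l2_opNorm_inv_le (hc : 0 < c) (hR : c • 1 ≤ R) : ‖R⁻¹‖ ≤ c⁻¹ := by
  refine l2_opNorm_le_of_forall (inv_nonneg.2 hc.le) fun x => ?_
  have h := mul_norm_le_norm_mulVec hR (R⁻¹ *ᵥ x)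
  rwa [mulVec_inv_mulVec (posDef_of_smul_one_le hc hR), ← le_inv_mul_iff₀ hc] at h

lemma smul_one_le_of_norm_sub_le {a : ℝ} (hR : R.IsHermitian) (h : ‖R - a • 1‖ ≤ a - c) :
    c • 1 ≤ R := by
  refine smul_one_le_iff.2 ⟨hR, fun x => ?_⟩
  have hdev : |x ⬝ᵥ (R - a • 1) *ᵥ x| ≤ (a - c) * ‖toLp 2 x‖ ^ 2 := by
    calc |x ⬝ᵥ (R - a • 1) *ᵥ x| ≤ ‖toLp 2 x‖ * (‖R - a • 1‖ * ‖toLp 2 x‖) :=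
          (abs_dotProduct_le_norm _ _).trans (by gcongr; exact norm_mulVec_le _ _)
      _ ≤ ‖toLp 2 x‖ * ((a - c) * ‖toLp 2 x‖) := by gcongr
      _ = (a - c) * ‖toLp 2 x‖ ^ 2 := by ring
  have hsplit : x ⬝ᵥ (R - a • 1) *ᵥ x = x ⬝ᵥ R *ᵥ x - a * ‖toLp 2 x‖ ^ 2 := by
    simp [sub_mulVec, smul_mulVec, dotProduct_sub, dotProduct_self_eq_norm_sq]
  linarith [(abs_le.1 hdev).1]

lemma smul_one_le_inv (hc : 0 < c) (hR : c • 1 ≤ R) (hW : ‖R‖ ≤ W) : (c / W ^ 2) • 1 ≤ R⁻¹ := by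
  have hpos := posDef_of_smul_one_le hc hR
  refine smul_one_le_iff.2 ⟨hpos.inv.isHermitian, fun x => ?_⟩
  obtain ⟨y, rfl⟩ : ∃ y, R *ᵥ y = x := ⟨_, mulVec_inv_mulVec hpos x⟩
  rw [inv_mulVec_mulVec hpos]
  calc c / W ^ 2 * ‖toLp 2 (R *ᵥ y)‖ ^ 2 ≤ c / W ^ 2 * (W * ‖toLp 2 y‖) ^ 2 := by
        gcongr
        exact (norm_mulVec_le _ _).trans (by gcongr)
    _ = c * ‖toLp 2 y‖ ^ 2 * (W ^ 2 / W ^ 2) := by ring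
    _ ≤ c * ‖toLp 2 y‖ ^ 2 := mul_le_of_le_one_right (by positivity) (div_self_le_one _)
    _ ≤ y ⬝ᵥ R *ᵥ y := (smul_one_le_iff.1 hR).2 y
    _ = R *ᵥ y ⬝ᵥ y := dotProduct_comm _ _

lemma mul_sum_sq_le_trace (hc : 0 < c) (hR : c • 1 ≤ R) (hW : ‖R‖ ≤ W)
    {A : Matrix ι ι ℝ} (hA : A.IsHermitian) :
    (c / W ^ 2) ^ 2 * ∑ i, ∑ j, A i j ^ 2 ≤ (R⁻¹ * A * R⁻¹ * A).trace := by
  set b := c / W ^ 2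
  have hinv : (R⁻¹ - b • 1).PosSemidef := le_iff.1 (smul_one_le_inv hc hR hW)
  have hconj {Q : Matrix ι ι ℝ} (hQ : Q.PosSemidef) : (A * Q * A).PosSemidef := by
    simpa only [hA.eq] using hQ.mul_mul_conjTranspose_same A
  have houter : 0 ≤ ((R⁻¹ - b • 1) * (A * R⁻¹ * A)).trace :=
    trace_mul_nonneg hinv (hconj (posDef_of_smul_one_le hc hR).inv.posSemidef)
  have hinner : 0 ≤ b * (A * (R⁻¹ - b • 1) * A).trace :=
    mul_nonneg (by positivity) (hconj hinv).trace_nonneg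
  have hfrob : (A * A).trace = ∑ i, ∑ j, A i j ^ 2 := by
    simp only [trace, diag_apply, mul_apply, sq]
    exact Finset.sum_congr rfl fun i _ => Finset.sum_congr rfl fun j _ => by
      rw [← hA.apply i j, star_trivial]
  simp only [sub_mul, mul_sub, smul_mul_assoc, mul_smul_comm, one_mul, mul_one, trace_sub,
    trace_smul, smul_eq_mul, hfrob] at houter hinner
  simp only [Matrix.mul_assoc] at houter hinner ⊢
  linarith

end Coercive

/-! ### Locality of products of matrices and inverses -/

section Cutoff

variable {G : Type*} [SeminormedAddCommGroup G] {ι : Type*} {m : G → ℝ} {u : ι → G} {a : G} {ρ : ℝ}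

/-- The cut-off at scale `ρ` about `a`: it vanishes at `a` and equals `1` outside the ball of
radius `ρ`. -/
noncomputable def cutoff (u : ι → G) (a : G) (ρ : ℝ) (i : ι) : ℝ :=
  min 1 (‖u i - a‖ / ρ)

/-- A bound for the commutator of the cut-off at scale `ρ` with a matrix dominated by the
convolution kernel `m`. -/
noncomputable def commutatorModulus (m : G → ℝ) (ρ : ℝ) : ℝ :=
  ∑' w, m w * min 1 (‖w‖ / ρ)

lemma cutoff_self (i : ι) : cutoff u (u i) ρ i = 0 := by
  simp [cutoff]

lemma cutoff_eq_one (hρ : 0 < ρ) {i : ι} (hi : ρ ≤ ‖u i - a‖) : cutoff u a ρ i = 1 :=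
  min_eq_left ((one_le_div hρ).2 hi)

lemma abs_cutoff_sub_le (hρ : 0 < ρ) (i j : ι) :
    |cutoff u a ρ i - cutoff u a ρ j| ≤ min 1 (‖u i - u j‖ / ρ) := by
  have cutoff_nonneg (k : ι) : 0 ≤ cutoff u a ρ k := le_min zero_le_one (by positivity)
  have cutoff_le_one (k : ι) : cutoff u a ρ k ≤ 1 := min_le_left _ _
  refine le_min (abs_sub_le_of_nonneg_of_le (cutoff_nonneg i) (cutoff_le_one i) (cutoff_nonneg j)
    (cutoff_le_one j)) ((abs_min_sub_min_le_max _ _ _ _).trans ?_)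
  rw [sub_self, abs_zero, max_eq_right (abs_nonneg _), ← sub_div, abs_div, abs_of_pos hρ]
  gcongr
  simpa using abs_norm_sub_norm_le (u i - a) (u j - a)

lemma tendsto_commutatorModulus (hm₀ : ∀ w, 0 ≤ m w) (hm : Summable m) :
    Tendsto (commutatorModulus m) atTop (𝓝 0) := by
  rw [← tsum_zero (α := ℝ) (β := G)]
  refine tendsto_tsum_of_dominated_convergence hm (fun w => ?_) ?_
  · have hlim : Tendsto (fun ρ : ℝ => ‖w‖ / ρ) atTop (𝓝 0) :=
      tendsto_const_nhds.div_atTop tendsto_id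
    simpa using (tendsto_const_nhds (x := m w)).mul ((tendsto_const_nhds (x := (1 : ℝ))).min hlim)
  · filter_upwards [eventually_ge_atTop 0] with ρ hρ w
    rw [Real.norm_of_nonneg (mul_nonneg (hm₀ w) (le_min zero_le_one (by positivity)))]
    exact mul_le_of_le_one_right (hm₀ w) (min_le_left _ _)

lemma norm_commutator_cutoff_le [Fintype ι] [DecidableEq ι] (hm₀ : ∀ w, 0 ≤ m w)
    (hm : Summable m) (hu : u.Injective) (hρ : 0 < ρ) {M : Matrix ι ι ℝ}
    (hM : ∀ i j, |M i j| ≤ m (u i - u j)) :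
    ‖diagonal (cutoff u a ρ) * M - M * diagonal (cutoff u a ρ)‖ ≤ commutatorModulus m ρ := by
  have hnonneg (w : G) : 0 ≤ m w * min 1 (‖w‖ / ρ) :=
    mul_nonneg (hm₀ w) (le_min zero_le_one (by positivity))
  refine l2_opNorm_le_tsum hnonneg (hm.of_nonneg_of_le hnonneg
    fun w => mul_le_of_le_one_right (hm₀ w) (min_le_left _ _)) hu fun i j => ?_
  rw [Matrix.sub_apply, diagonal_mul, mul_diagonal, mul_comm (M i j), ← sub_mul, abs_mul, mul_comm]
  exact mul_le_mul (hM i j) (abs_cutoff_sub_le hρ i j) (abs_nonneg _) (hm₀ _)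

end Cutoff

section Locality

variable {ι κ : Type*} [Fintype ι] [Fintype κ] [DecidableEq ι]
  {e : κ → ι} {χ : ι → ℝ} {γ η W ω c : ℝ} {x : ι → ℝ} {x' : κ → ℝ} {A B R : Matrix ι ι ℝ}

/-- The vector `x` is concentrated where the cut-off `χ` is small, and on the block embedded by
`e` it nearly agrees with `x'`. -/
structure TracksOnBlock (e : κ → ι) (χ : ι → ℝ) (γ η : ℝ) (x : ι → ℝ) (x' : κ → ℝ) : Prop where
  norm_le : ‖toLp 2 x‖ ≤ γ
  norm_cutoff_le : ‖toLp 2 (χ * x)‖ ≤ η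
  norm_comp_sub_le : ‖toLp 2 (x ∘ e - x')‖ ≤ η

lemma norm_cutoff_mul_mulVec_sub_le (h : ‖diagonal χ * A - A * diagonal χ‖ ≤ ω) :
    ‖toLp 2 (χ * (A *ᵥ x) - A *ᵥ (χ * x))‖ ≤ ω * ‖toLp 2 x‖ := by
  have hdiag (y : ι → ℝ) : χ * y = diagonal χ *ᵥ y := by
    ext i
    rw [mulVec_diagonal, Pi.mul_apply]
  rw [hdiag, hdiag, mulVec_mulVec, mulVec_mulVec, ← sub_mulVec]
  exact (norm_mulVec_le _ _).trans (by gcongr)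

lemma norm_mulVec_comp_sub_submatrix_mulVec_le (he : e.Injective)
    (hχ : ∀ i ∉ Set.range e, 1 ≤ |χ i|) :
    ‖toLp 2 ((A *ᵥ x) ∘ e - A.submatrix e e *ᵥ (x ∘ e))‖ ≤ ‖A‖ * ‖toLp 2 (χ * x)‖ := by
  rw [submatrix_mulVec_eq_mulVec_extend he, ← Pi.sub_comp, ← mulVec_sub]
  refine (norm_toLp_comp_le he _).trans ((norm_mulVec_le _ _).trans ?_)
  refine mul_le_mul_of_nonneg_left (le_of_sq_le_sq ?_ (norm_nonneg _)) (norm_nonneg _)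
  rw [norm_toLp_sq, norm_toLp_sq]
  refine Finset.sum_le_sum fun i _ => ?_
  by_cases hi : i ∈ Set.range e
  · obtain ⟨k, rfl⟩ := hi
    rw [Pi.sub_apply, he.extend_apply, Function.comp_apply, sub_self, zero_pow two_ne_zero]
    positivity
  · rw [Pi.sub_apply, Function.extend_apply' _ _ _ hi, Pi.zero_apply, sub_zero, Pi.mul_apply,
      mul_pow, ← sq_abs (χ i)]
    exact le_mul_of_one_le_left (sq_nonneg _) (one_le_pow₀ (hχ i hi))

lemma TracksOnBlock.mulVec (h : TracksOnBlock e χ γ η x x') (he : e.Injective)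
    (hχ : ∀ i ∉ Set.range e, 1 ≤ |χ i|) (hA : ‖A‖ ≤ W)
    (hω : ‖diagonal χ * A - A * diagonal χ‖ ≤ ω) :
    TracksOnBlock e χ (W * γ) (2 * (W * η) + ω * γ) (A *ᵥ x) (A.submatrix e e *ᵥ x') := by
  have hω₀ : 0 ≤ ω := (norm_nonneg _).trans hω
  have hW₀ : 0 ≤ W := (norm_nonneg _).trans hA
  have hωγ : ω * ‖toLp 2 x‖ ≤ ω * γ := mul_le_mul_of_nonneg_left h.norm_le hω₀
  have hη₀ : 0 ≤ η := (norm_nonneg _).trans h.norm_cutoff_le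
  have hγ₀ : 0 ≤ γ := (norm_nonneg _).trans h.norm_le
  classical
  refine ⟨(norm_mulVec_le _ _).trans (mul_le_mul hA h.norm_le (norm_nonneg _) hW₀), ?_, ?_⟩
  · calc ‖toLp 2 (χ * (A *ᵥ x))‖
        = ‖toLp 2 (A *ᵥ (χ * x)) + toLp 2 (χ * (A *ᵥ x) - A *ᵥ (χ * x))‖ := by
          rw [← toLp_add, add_sub_cancel]
      _ ≤ W * η + ω * ‖toLp 2 x‖ := norm_add_le_of_le
          ((norm_mulVec_le _ _).trans (mul_le_mul hA h.norm_cutoff_le (norm_nonneg _) hW₀))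
          (norm_cutoff_mul_mulVec_sub_le hω)
      _ ≤ 2 * (W * η) + ω * γ := by linarith [mul_nonneg hW₀ hη₀]
  · calc ‖toLp 2 ((A *ᵥ x) ∘ e - A.submatrix e e *ᵥ x')‖
        = ‖toLp 2 ((A *ᵥ x) ∘ e - A.submatrix e e *ᵥ (x ∘ e)) +
            toLp 2 (A.submatrix e e *ᵥ (x ∘ e - x'))‖ := by
          rw [← toLp_add, mulVec_sub, sub_add_sub_cancel]
      _ ≤ W * η + W * η := norm_add_le_of_le
          ((norm_mulVec_comp_sub_submatrix_mulVec_le he hχ).trans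
            (mul_le_mul hA h.norm_cutoff_le (norm_nonneg _) hW₀))
          ((norm_mulVec_le _ _).trans (mul_le_mul ((l2_opNorm_submatrix_le he A).trans hA)
            h.norm_comp_sub_le (norm_nonneg _) hW₀))
      _ ≤ 2 * (W * η) + ω * γ := by linarith [mul_nonneg hω₀ hγ₀]

variable [DecidableEq κ]

lemma tracksOnBlock_single {k : κ} (he : e.Injective) (hχ : χ (e k) = 0) :
    TracksOnBlock e χ 1 0 (Pi.single (e k) 1) (Pi.single k 1) where
  norm_le := by simp
  norm_cutoff_le := by
    have : χ * Pi.single (e k) 1 = 0 := by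
      ext i
      by_cases hi : i = e k <;> simp [hi, hχ]
    simp [this]
  norm_comp_sub_le := by
    have : (Pi.single (e k) 1 : ι → ℝ) ∘ e = Pi.single k 1 := by
      ext l
      simp [Pi.single_apply, he.eq_iff]
    simp [this]

lemma TracksOnBlock.inv_mulVec (h : TracksOnBlock e χ γ η x x') (he : e.Injective)
    (hχ : ∀ i ∉ Set.range e, 1 ≤ |χ i|) (hc : 0 < c) (hR : c • 1 ≤ R) (hW : ‖R‖ ≤ W)
    (hω : ‖diagonal χ * R - R * diagonal χ‖ ≤ ω) :
    TracksOnBlock e χ (c⁻¹ * γ) (c⁻¹ * (1 + c⁻¹ * W) * (η + ω * (c⁻¹ * γ)))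
      (R⁻¹ *ᵥ x) ((R.submatrix e e)⁻¹ *ᵥ x') := by
  have hω₀ : 0 ≤ ω := (norm_nonneg _).trans hω
  have hW₀ : 0 ≤ W := (norm_nonneg _).trans hW
  have hη₀ : 0 ≤ η := (norm_nonneg _).trans h.norm_cutoff_le
  have hγ₀ : 0 ≤ γ := (norm_nonneg _).trans h.norm_le
  have hc₀ : 0 ≤ c⁻¹ := inv_nonneg.2 hc.le
  have hR' := smul_one_le_submatrix he hR
  set y := R⁻¹ *ᵥ x
  have hRy : R *ᵥ y = x := mulVec_inv_mulVec (posDef_of_smul_one_le hc hR) x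
  have hy_norm : ‖toLp 2 y‖ ≤ c⁻¹ * γ := (norm_mulVec_le _ _).trans
    (mul_le_mul (l2_opNorm_inv_le hc hR) h.norm_le (norm_nonneg _) hc₀)
  have hcut : ‖toLp 2 (χ * y)‖ ≤ c⁻¹ * (η + ω * (c⁻¹ * γ)) := by
    refine (le_inv_mul_iff₀ hc).2 ((mul_norm_le_norm_mulVec hR _).trans ?_)
    rw [← sub_sub_cancel (χ * (R *ᵥ y)) (R *ᵥ (χ * y)), toLp_sub]
    refine norm_sub_le_of_le (hRy ▸ h.norm_cutoff_le) ?_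
    exact (norm_cutoff_mul_mulVec_sub_le hω).trans (by gcongr)
  have hcut_le : c⁻¹ * (η + ω * (c⁻¹ * γ)) ≤ c⁻¹ * (1 + c⁻¹ * W) * (η + ω * (c⁻¹ * γ)) := by
    rw [mul_right_comm]
    exact le_mul_of_one_le_right (by positivity) (le_add_of_nonneg_right (by positivity))
  refine ⟨hy_norm, hcut.trans hcut_le, ?_⟩
  rw [mul_assoc, le_inv_mul_iff₀ hc]
  refine (mul_norm_le_norm_mulVec hR' _).trans ?_
  rw [mulVec_sub, mulVec_inv_mulVec (posDef_of_smul_one_le hc hR')]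
  calc ‖toLp 2 (R.submatrix e e *ᵥ (y ∘ e) - x')‖
      = ‖toLp 2 (x ∘ e - x') - toLp 2 ((R *ᵥ y) ∘ e - R.submatrix e e *ᵥ (y ∘ e))‖ := by
        rw [← toLp_sub, hRy]
        congr 2
        abel
    _ ≤ η + W * (c⁻¹ * (η + ω * (c⁻¹ * γ))) := norm_sub_le_of_le h.norm_comp_sub_le
        ((norm_mulVec_comp_sub_submatrix_mulVec_le he hχ).trans
          (mul_le_mul hW hcut (norm_nonneg _) hW₀))
    _ ≤ (1 + c⁻¹ * W) * (η + ω * (c⁻¹ * γ)) := by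
        have : 0 ≤ ω * (c⁻¹ * γ) := by positivity
        linarith

/-- The product `R⁻¹ A R⁻¹ B`, half of which is the matrix `M_ML` of the model when `A` and `B` are
partial derivatives of `R`. -/
noncomputable def sandwich (R A B : Matrix ι ι ℝ) : Matrix ι ι ℝ :=
  R⁻¹ * A * R⁻¹ * B

/-- A bound for the entries of `R⁻¹ A R⁻¹ B` when `c • 1 ≤ R` and `A`, `B` have norm at most
`W`. -/
noncomputable def sandwichBound (c W : ℝ) : ℝ :=
  (c⁻¹ * W) ^ 2

/-- The factor by which a commutator bound controls the change of the entries of `R⁻¹ A R⁻¹ B`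
under restriction of `R`, `A` and `B` to a block. -/
noncomputable def sandwichModulus (c W : ℝ) : ℝ :=
  c⁻¹ * (c⁻¹ * W) * (1 + c⁻¹ * W) ^ 2 * (3 + 2 * (c⁻¹ * W))

omit [Fintype κ] [DecidableEq κ] in
lemma sandwich_apply_self (i : ι) :
    sandwich R A B i i = (R⁻¹ *ᵥ A *ᵥ R⁻¹ *ᵥ B *ᵥ Pi.single i 1) i := by
  have hcol : sandwich R A B i i = (sandwich R A B *ᵥ Pi.single i 1) i := by
    rw [mulVec_single_one, col_apply]
  rw [hcol, sandwich, ← mulVec_mulVec, ← mulVec_mulVec, ← mulVec_mulVec]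

lemma abs_sandwich_apply_sub_le (he : e.Injective) (hχ : ∀ i ∉ Set.range e, 1 ≤ |χ i|)
    (hc : 0 < c) (hR : c • 1 ≤ R) (hRW : ‖R‖ ≤ W) (hAW : ‖A‖ ≤ W) (hBW : ‖B‖ ≤ W)
    (hRω : ‖diagonal χ * R - R * diagonal χ‖ ≤ ω) (hAω : ‖diagonal χ * A - A * diagonal χ‖ ≤ ω)
    (hBω : ‖diagonal χ * B - B * diagonal χ‖ ≤ ω) {k : κ} (hk : χ (e k) = 0) :
    |sandwich R A B (e k) (e k) -
      sandwich (R.submatrix e e) (A.submatrix e e) (B.submatrix e e) k k| ≤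
      sandwichModulus c W * ω := by
  have h := ((((tracksOnBlock_single he hk).mulVec he hχ hBW hBω).inv_mulVec he hχ hc hR hRW
    hRω).mulVec he hχ hAW hAω).inv_mulVec he hχ hc hR hRW hRω
  rw [sandwich_apply_self, sandwich_apply_self]
  refine ((PiLp.norm_apply_le (toLp 2 _) k).trans h.norm_comp_sub_le).trans_eq ?_
  rw [sandwichModulus]
  ring

omit [Fintype κ] [DecidableEq κ] in
lemma abs_sandwich_apply_le (hc : 0 < c) (hR : c • 1 ≤ R) (hAW : ‖A‖ ≤ W) (hBW : ‖B‖ ≤ W)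
    (i : ι) : |sandwich R A B i i| ≤ sandwichBound c W := by
  have hW : 0 ≤ W := (norm_nonneg _).trans hAW
  have hinv (x : ι → ℝ) : ‖toLp 2 (R⁻¹ *ᵥ x)‖ ≤ c⁻¹ * ‖toLp 2 x‖ :=
    (norm_mulVec_le _ _).trans (by gcongr; exact l2_opNorm_inv_le hc hR)
  have hmul {M : Matrix ι ι ℝ} (hM : ‖M‖ ≤ W) (x : ι → ℝ) :
      ‖toLp 2 (M *ᵥ x)‖ ≤ W * ‖toLp 2 x‖ := (norm_mulVec_le _ _).trans (by gcongr)
  rw [sandwich_apply_self]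
  calc |(R⁻¹ *ᵥ A *ᵥ R⁻¹ *ᵥ B *ᵥ Pi.single i 1) i|
      ≤ ‖toLp 2 (R⁻¹ *ᵥ A *ᵥ R⁻¹ *ᵥ B *ᵥ Pi.single i 1)‖ :=
        PiLp.norm_apply_le (toLp 2 (R⁻¹ *ᵥ A *ᵥ R⁻¹ *ᵥ B *ᵥ Pi.single i 1)) i
    _ ≤ c⁻¹ * (W * (c⁻¹ * (W * ‖toLp 2 (Pi.single i (1 : ℝ))‖))) := by
        refine (hinv _).trans ?_
        gcongr
        refine (hmul hAW _).trans ?_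
        gcongr
        refine (hinv _).trans ?_
        gcongr
        exact hmul hBW _
    _ = sandwichBound c W := by
        rw [sandwichBound, PiLp.toLp_single, PiLp.norm_single, norm_one]
        ring

omit [Fintype κ] [DecidableEq κ] in
lemma trace_sandwich_comm : (sandwich R A B).trace = (sandwich R B A).trace := by
  rw [sandwich, sandwich, Matrix.mul_assoc (R⁻¹ * A), trace_mul_comm, ← Matrix.mul_assoc]

omit [Fintype κ] [DecidableEq κ] in
lemma trace_sandwich_sum {p : Type*} [Fintype p] (R : Matrix ι ι ℝ) (D : p → Matrix ι ι ℝ)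
    (lam : p → ℝ) : (sandwich R (∑ k, lam k • D k) (∑ k, lam k • D k)).trace =
      ∑ i, ∑ j, lam i * lam j * (sandwich R (D i) (D j)).trace := by
  simp only [sandwich, Matrix.sum_mul, trace_sum, Matrix.mul_smul,
    Matrix.smul_mul, trace_smul, smul_eq_mul, Finset.mul_sum]
  rw [Finset.sum_comm]
  exact Finset.sum_congr rfl fun i _ => Finset.sum_congr rfl fun j _ => by
    ring

end Locality

/-! ### Covariance matrices of stationary fields -/

section KernelMatrix

variable {E ι : Type*}

/-- The covariance matrix `k (y i - y j)` of a stationary field with covariance function `k`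
observed at the points `y i`. -/
def kernelMatrix [Sub E] (k : E → ℝ) (y : ι → E) : Matrix ι ι ℝ :=
  Matrix.of fun i j => k (y i - y j)

lemma kernelMatrix_apply [Sub E] (k : E → ℝ) (y : ι → E) (i j : ι) :
    kernelMatrix k y i j = k (y i - y j) := rfl

lemma isHermitian_kernelMatrix [AddGroup E] {k : E → ℝ} (hk : ∀ t, k (-t) = k t) (y : ι → E) :
    (kernelMatrix k y).IsHermitian :=
  IsHermitian.ext fun i j => by
    rw [star_trivial, kernelMatrix_apply, kernelMatrix_apply, ← neg_sub, hk]

end KernelMatrix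

section CosTransform

variable {E : Type*} [NormedAddCommGroup E] [InnerProductSpace ℝ E] [FiniteDimensional ℝ E]
  [MeasurableSpace E] [BorelSpace E] {g g₁ g₂ : E → ℝ} {ι : Type*}

/-- The cosine transform `t ↦ ∫ g(f) cos(f·t) df`, i.e. the stationary covariance function with
spectral density `g` when `g` is nonnegative and even. -/
noncomputable def cosTransform (g : E → ℝ) (t : E) : ℝ :=
  ∫ f, g f * Real.cos (inner ℝ f t)

lemma integrable_mul_cos (hg : Integrable g) (t : E) :
    Integrable fun f => g f * Real.cos (inner ℝ f t) :=
  hg.mul_bdd (c := 1) (Continuous.aestronglyMeasurable (by fun_prop))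
    (ae_of_all _ fun f => Real.abs_cos_le_one _)

lemma cosTransform_neg (g : E → ℝ) (t : E) : cosTransform g (-t) = cosTransform g t := by
  simp only [cosTransform, inner_neg_right, Real.cos_neg]

lemma cosTransform_sub (h₁ : Integrable g₁) (h₂ : Integrable g₂) (t : E) :
    cosTransform (g₁ - g₂) t = cosTransform g₁ t - cosTransform g₂ t := by
  simp only [cosTransform, Pi.sub_apply, sub_mul]
  exact integral_sub (integrable_mul_cos h₁ t) (integrable_mul_cos h₂ t)

lemma cosTransform_smul (a : ℝ) (g : E → ℝ) (t : E) :
    cosTransform (a • g) t = a * cosTransform g t := by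
  simp only [cosTransform, Pi.smul_apply, smul_eq_mul, mul_assoc]
  exact integral_const_mul _ _

lemma cosTransform_comp_inv_smul {M : ℝ} (hM : 0 < M) (g : E → ℝ) (t : E) :
    cosTransform (fun f => g (M⁻¹ • f)) t = M ^ Module.finrank ℝ E * cosTransform g (M • t) := by
  have hscale (f : E) : inner ℝ (M⁻¹ • f) (M • t) = inner ℝ f t := by
    rw [real_inner_smul_left, real_inner_smul_right, inv_mul_cancel_left₀ hM.ne']
  simpa only [cosTransform, hscale, abs_of_pos (pow_pos hM _), smul_eq_mul] using
    Measure.integral_comp_inv_smul volume (fun f : E => g f * Real.cos (inner ℝ f (M • t))) M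

lemma continuous_cosTransform (hg : Integrable g) : Continuous (cosTransform g) :=
  continuous_of_dominated (fun t => (integrable_mul_cos hg t).aestronglyMeasurable)
    (fun t => ae_of_all _ fun f => by
      rw [norm_mul]
      exact mul_le_of_le_one_right (norm_nonneg _) (Real.abs_cos_le_one _)) hg.norm
    (ae_of_all _ fun f => by fun_prop)

lemma dotProduct_kernelMatrix_cosTransform [Fintype ι] (hg : Integrable g) (y : ι → E)
    (x : ι → ℝ) :
    x ⬝ᵥ kernelMatrix (cosTransform g) y *ᵥ x =
      ∫ f, g f * ((∑ i, x i * Real.cos (inner ℝ f (y i))) ^ 2 +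
        (∑ i, x i * Real.sin (inner ℝ f (y i))) ^ 2) := by
  have hint (i j : ι) : Integrable fun f =>
      x i * (g f * Real.cos (inner ℝ f (y i - y j)) * x j) :=
    ((integrable_mul_cos hg _).mul_const _).const_mul _
  calc x ⬝ᵥ kernelMatrix (cosTransform g) y *ᵥ x
      = ∫ f, ∑ i, ∑ j, x i * (g f * Real.cos (inner ℝ f (y i - y j)) * x j) := by
        rw [integral_finsetSum _ fun i _ => integrable_finsetSum _ fun j _ => hint i j]
        simp only [dotProduct, mulVec, kernelMatrix_apply, Finset.mul_sum]
        refine Finset.sum_congr rfl fun i _ => ?_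
        rw [integral_finsetSum _ fun j _ => hint i j]
        exact Finset.sum_congr rfl fun j _ => by
          rw [integral_const_mul, integral_mul_const, cosTransform]
    _ = _ := by
        refine integral_congr_ae (ae_of_all _ fun f => ?_)
        beta_reduce
        rw [sq, sq, Finset.sum_mul_sum, Finset.sum_mul_sum]
        simp only [← Finset.sum_add_distrib, Finset.mul_sum]
        refine Finset.sum_congr rfl fun i _ => Finset.sum_congr rfl fun j _ => ?_
        rw [inner_sub_right, Real.cos_sub]
        ring

lemma posSemidef_kernelMatrix_cosTransform [Finite ι] (hg : Integrable g) (hg₀ : ∀ f, 0 ≤ g f)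
    (y : ι → E) : (kernelMatrix (cosTransform g) y).PosSemidef := by
  cases nonempty_fintype ι
  refine .of_dotProduct_mulVec_nonneg (isHermitian_kernelMatrix (cosTransform_neg g) y) fun x => ?_
  rw [star_trivial, dotProduct_kernelMatrix_cosTransform hg]
  exact integral_nonneg fun f => mul_nonneg (hg₀ f) (by positivity)

lemma kernelMatrix_cosTransform_mono [Finite ι] (h₁ : Integrable g₁) (h₂ : Integrable g₂)
    (hle : ∀ f, g₁ f ≤ g₂ f) (y : ι → E) :
    kernelMatrix (cosTransform g₁) y ≤ kernelMatrix (cosTransform g₂) y := by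
  have hsub : kernelMatrix (cosTransform g₂) y - kernelMatrix (cosTransform g₁) y =
      kernelMatrix (cosTransform (g₂ - g₁)) y := by
    ext i j
    exact (cosTransform_sub h₂ h₁ _).symm
  rw [le_iff, hsub]
  exact posSemidef_kernelMatrix_cosTransform (h₂.sub h₁) (fun f => sub_nonneg.2 (hle f)) y

lemma exists_pow_mul_abs_cosTransform_le (h : ContDiffBump (0 : E)) (n : ℕ) :
    ∃ C, 0 < C ∧ ∀ t, ‖t‖ ^ n * |cosTransform h t| ≤ C := by
  let S : SchwartzMap E ℂ := HasCompactSupport.toSchwartzMap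
    (h.hasCompactSupport.comp_left (g := ((↑) : ℝ → ℂ)) Complex.ofReal_zero)
    (Complex.ofRealCLM.contDiff.comp h.contDiff)
  obtain ⟨C, hC, hdecay⟩ := (FourierTransform.fourier S).decay n 0
  refine ⟨(2 * Real.pi) ^ n * C, by positivity, fun t => ?_⟩
  have hre : cosTransform h t = (FourierTransform.fourier S ((2 * Real.pi)⁻¹ • t)).re := by
    have hint : Integrable fun v : E =>
        Complex.exp (↑(-2 * Real.pi * inner ℝ v ((2 * Real.pi)⁻¹ • t)) * Complex.I) • S v :=
      (S.integrable (μ := volume)).bdd_mul (c := 1)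
        (Continuous.aestronglyMeasurable (by fun_prop))
        (ae_of_all _ fun v => (Complex.norm_exp_ofReal_mul_I _).le)
    rw [SchwartzMap.fourier_coe, Real.fourier_eq', ← RCLike.re_eq_complex_re, ← integral_re hint,
      cosTransform]
    refine integral_congr_ae (ae_of_all _ fun v => ?_)
    have hinner : -2 * Real.pi * inner ℝ v ((2 * Real.pi)⁻¹ • t) = -inner ℝ v t := by
      rw [real_inner_smul_right]
      field_simp
    have hS : S v = (h v : ℂ) := rfl
    simp only [hinner, hS, smul_eq_mul, RCLike.re_eq_complex_re]
    rw [Complex.re_mul_ofReal, Complex.exp_ofReal_mul_I_re, Real.cos_neg, mul_comm]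
  have hpow := hdecay ((2 * Real.pi)⁻¹ • t)
  rw [norm_iteratedFDeriv_zero, norm_smul, mul_pow, norm_inv, Real.norm_of_nonneg
    Real.two_pi_pos.le, inv_pow, mul_assoc, inv_mul_le_iff₀ (by positivity)] at hpow
  rw [hre]
  exact (mul_le_mul_of_nonneg_left (Complex.abs_re_le_norm _) (by positivity)).trans hpow

lemma exists_pos_smul_le_of_hasCompactSupport {X : Type*} [TopologicalSpace X] {g h : X → ℝ}
    (hg : Continuous g) (hg₀ : ∀ f, 0 < g f) (hsupp : HasCompactSupport h) (h₁ : ∀ f, h f ≤ 1) :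
    ∃ b, 0 < b ∧ ∀ f, b * h f ≤ g f := by
  rcases (tsupport h).eq_empty_or_nonempty with hempty | hne
  · refine ⟨1, one_pos, fun f => ?_⟩
    rw [tsupport_eq_empty_iff.1 hempty, Pi.zero_apply, mul_zero]
    exact (hg₀ f).le
  · obtain ⟨f₀, -, hmin⟩ := hsupp.isCompact.exists_isMinOn hne hg.continuousOn
    refine ⟨g f₀, hg₀ f₀, fun f => ?_⟩
    by_cases hf : f ∈ tsupport h
    · exact (mul_le_of_le_one_right (hg₀ f₀).le (h₁ f)).trans (hmin hf)
    · rw [image_eq_zero_of_notMem_tsupport hf, mul_zero]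
      exact (hg₀ f).le

end CosTransform

/-! ### Uniform coercivity on separated configurations -/

section Separated

variable {d : ℕ} {E : Type*} [SeminormedAddCommGroup E]

/-- The points `y i`, labelled by distinct lattice points `u i`, are at least as far apart as
their labels, up to the factor `δ`. The label norm is the supremum norm. -/
structure IsSeparated {ι : Type*} (δ : ℝ) (u : ι → Fin d → ℤ) (y : ι → E) : Prop where
  injective : u.Injective
  le_norm_sub : ∀ i j, δ * ‖u i - u j‖ ≤ ‖y i - y j‖

/-- The covariance matrices of the kernel `k` on finite `δ`-separated configurations, labelled by
`d`-dimensional lattice points, are bounded below by `c` in the Loewner order. -/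
def IsUniformlyCoercive (d : ℕ) (δ c : ℝ) (k : E → ℝ) : Prop :=
  ∀ (ι : Type) [Fintype ι] [DecidableEq ι] (u : ι → Fin d → ℤ) (y : ι → E),
    IsSeparated δ u y → c • 1 ≤ kernelMatrix k y

lemma summable_norm_pow_inv (d : ℕ) : Summable fun w : Fin d → ℤ => (‖w‖ ^ (d + 1))⁻¹ := by
  let b := Pi.basisFun ℝ (Fin d)
  let Λ : Submodule ℤ (Fin d → ℝ) := Submodule.span ℤ (Set.range b)
  have hmem (w : Fin d → ℤ) : (fun k => (w k : ℝ)) ∈ Λ :=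
    (b.mem_span_iff_repr_mem ℤ _).2 fun i => ⟨w i, by simp [b]⟩
  have hrank : Module.finrank ℤ Λ = d := by
    rw [ZLattice.rank ℝ, Module.finrank_fin_fun]
  have hinj : Function.Injective fun w : Fin d → ℤ => (⟨fun k => (w k : ℝ), hmem w⟩ : Λ) :=
    fun w w' h => funext fun k => Int.cast_injective (congrFun (congrArg Subtype.val h) k)
  refine ((ZLattice.summable_norm_pow_inv Λ (d + 1) (by omega)).comp_injective hinj).congr
    fun w => ?_
  have hnorm : ‖(fun k => (w k : ℝ))‖ = ‖w‖ := by
    simp only [Pi.norm_def]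
    congr 2
  simp [hnorm]

lemma exists_isUniformlyCoercive_of_decay {k : E → ℝ} {C : ℝ} (hk : ∀ t, k (-t) = k t)
    (hC : 0 ≤ C) (hdecay : ∀ t, ‖t‖ ^ (d + 1) * |k t| ≤ C) (hk₀ : 0 < k 0) :
    ∃ Δ, 0 < Δ ∧ IsUniformlyCoercive d Δ (k 0 / 2) k := by
  set S := ∑' w : Fin d → ℤ, (‖w‖ ^ (d + 1))⁻¹
  have hlim : Tendsto (fun Δ : ℝ => C / Δ ^ (d + 1) * S) atTop (𝓝 0) := by
    simpa using ((tendsto_const_nhds (x := C)).div_atTop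
      (tendsto_pow_atTop (Nat.succ_ne_zero d))).mul_const S
  obtain ⟨Δ, hΔ, hΔS⟩ := ((eventually_gt_atTop 0).and (hlim.eventually_le_const
    (half_pos hk₀))).exists
  refine ⟨Δ, hΔ, fun ι _ _ u y hy =>
    smul_one_le_of_norm_sub_le (isHermitian_kernelMatrix hk y) ?_ (a := k 0)⟩
  rw [sub_half]
  refine (l2_opNorm_le_tsum (m := fun w => C / Δ ^ (d + 1) * (‖w‖ ^ (d + 1))⁻¹)
    (fun w => by positivity) ((summable_norm_pow_inv d).mul_left _) hy.injective
    fun i j => ?_).trans ?_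
  · rcases eq_or_ne i j with rfl | hij
    · simp only [Matrix.sub_apply, kernelMatrix_apply, sub_self, Matrix.smul_apply, one_apply_eq,
        smul_eq_mul, mul_one, abs_zero]
      positivity
    · have hnorm : 0 < ‖u i - u j‖ := norm_pos_iff.2 (sub_ne_zero.2 (hy.injective.ne hij))
      rw [Matrix.sub_apply, Matrix.smul_apply, one_apply_ne hij, smul_zero, sub_zero,
        kernelMatrix_apply, ← div_eq_mul_inv, div_div, ← mul_pow, le_div_iff₀ (by positivity),
        mul_comm]
      exact (mul_le_mul_of_nonneg_right (pow_le_pow_left₀ (by positivity) (hy.le_norm_sub i j) _)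
        (abs_nonneg _)).trans (hdecay _)
  · rwa [tsum_mul_left]

theorem exists_isUniformlyCoercive_cosTransform {g : EuclideanSpace ℝ (Fin d) → ℝ}
    (hg : Integrable g) (hgc : Continuous g) (hg₀ : ∀ f, 0 < g f) {δ : ℝ} (hδ : 0 < δ) :
    ∃ c, 0 < c ∧ IsUniformlyCoercive d δ c (cosTransform g) := by
  let h : ContDiffBump (0 : EuclideanSpace ℝ (Fin d)) := ⟨1, 2, one_pos, one_lt_two⟩
  have hh₀ : 0 < cosTransform h 0 := by
    simpa only [cosTransform, inner_zero_right, Real.cos_zero, mul_one] using h.integral_pos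
  obtain ⟨C, hC, hdecay⟩ := exists_pow_mul_abs_cosTransform_le h (d + 1)
  obtain ⟨Δ, hΔ, hcoercive⟩ :=
    exists_isUniformlyCoercive_of_decay (cosTransform_neg h) hC.le hdecay hh₀
  set M := Δ / δ
  have hM : 0 < M := div_pos hΔ hδ
  let scaledBump : EuclideanSpace ℝ (Fin d) → ℝ := fun f => h (M⁻¹ • f)
  have hsupp : HasCompactSupport scaledBump := h.hasCompactSupport.comp_smul (inv_ne_zero hM.ne')
  have hint : Integrable scaledBump :=
    (h.continuous.comp (continuous_const_smul _)).integrable_of_hasCompactSupport hsupp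
  obtain ⟨b, hb, hbg⟩ :=
    exists_pos_smul_le_of_hasCompactSupport hgc hg₀ hsupp fun _ => h.le_one
  refine ⟨b * M ^ d * (cosTransform h 0 / 2), by positivity, fun ι _ _ u y hy => ?_⟩
  have hyM : IsSeparated Δ u (M • y) := by
    refine ⟨hy.injective, fun i j => ?_⟩
    rw [Pi.smul_apply, Pi.smul_apply, ← smul_sub, norm_smul, Real.norm_of_nonneg hM.le,
      ← div_mul_cancel₀ Δ hδ.ne', mul_assoc]
    exact mul_le_mul_of_nonneg_left (hy.le_norm_sub i j) hM.le
  calc (b * M ^ d * (cosTransform h 0 / 2)) • (1 : Matrix _ _ ℝ)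
      = (b * M ^ d) • ((cosTransform h 0 / 2) • (1 : Matrix _ _ ℝ)) := mul_smul _ _ _
    _ ≤ (b * M ^ d) • kernelMatrix (cosTransform h) (M • y) :=
        smul_le_smul_of_nonneg_left (hcoercive ι u _ hyM) (by positivity)
    _ = kernelMatrix (cosTransform (b • scaledBump)) y := by
        ext i j
        rw [Matrix.smul_apply, kernelMatrix_apply, kernelMatrix_apply, cosTransform_smul,
          cosTransform_comp_inv_smul hM, finrank_euclideanSpace_fin, smul_eq_mul, mul_assoc,
          smul_sub]
        rfl
    _ ≤ kernelMatrix (cosTransform g) y :=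
        kernelMatrix_cosTransform_mono (hint.smul b) hg hbg y

end Separated

/-! ### A law of large numbers for locally dependent variables -/

section LawOfLargeNumbers

variable {Ω : Type*} [MeasurableSpace Ω] {P : Measure Ω}

lemma ae_tendsto_zero_of_summable_integral {Y : ℕ → Ω → ℝ} (hY : ∀ k, Integrable (Y k) P)
    (hY₀ : ∀ k, 0 ≤ Y k) (hsum : Summable fun k => ∫ ω, Y k ω ∂P) :
    ∀ᵐ ω ∂P, Tendsto (Y · ω) atTop (𝓝 0) := by
  have hmeas (k : ℕ) : AEMeasurable (fun ω => ENNReal.ofReal (Y k ω)) P :=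
    (hY k).aestronglyMeasurable.aemeasurable.ennreal_ofReal
  have hfin : ∫⁻ ω, ∑' k, ENNReal.ofReal (Y k ω) ∂P ≠ ⊤ := by
    rw [lintegral_tsum hmeas]
    simp only [← ofReal_integral_eq_lintegral_ofReal (hY _) (ae_of_all _ (hY₀ _))]
    rw [← ENNReal.ofReal_tsum_of_nonneg (fun k => integral_nonneg (hY₀ k)) hsum]
    exact ENNReal.ofReal_ne_top
  filter_upwards [ae_lt_top' (AEMeasurable.tsum hmeas) hfin] with ω hω
  simpa [Function.comp_def, ENNReal.toReal_ofReal (hY₀ _ _)] using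
    (ENNReal.tendsto_toReal ENNReal.zero_ne_top).comp
      (ENNReal.tendsto_atTop_zero_of_tsum_ne_top hω.ne)

lemma tendsto_average_of_tendsto_average_sq {U : ℕ → ℝ} {C : ℝ} (hU : ∀ n, |U n| ≤ C)
    (h : Tendsto (fun k : ℕ => (∑ i ∈ Finset.range (k ^ 2), U i) / (k : ℝ) ^ 2) atTop (𝓝 0)) :
    Tendsto (fun n : ℕ => (∑ i ∈ Finset.range n, U i) / n) atTop (𝓝 0) := by
  have hsplit (n : ℕ) : ∑ i ∈ Finset.range n, (U i + C) =
      ∑ i ∈ Finset.range n, U i + C * n := by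
    rw [Finset.sum_add_distrib, Finset.sum_const, Finset.card_range, nsmul_eq_mul, mul_comm]
  have hmono : Monotone fun n => ∑ i ∈ Finset.range n, (U i + C) :=
    monotone_nat_of_le_succ fun n => by
      rw [Finset.sum_range_succ]
      linarith [neg_le_of_abs_le (hU n)]
  have hshift : Tendsto (fun n : ℕ => (∑ i ∈ Finset.range n, (U i + C)) / n) atTop (𝓝 C) := by
    refine tendsto_div_of_monotone_of_exists_subseq_tendsto_div _ C hmono fun a ha =>
      ⟨fun k => k ^ 2, ?_, tendsto_pow_atTop two_ne_zero, ?_⟩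
    · have hratio : Tendsto (fun k : ℕ => ((k : ℝ) / (k + 1)) ^ 2) atTop (𝓝 (1 ^ 2)) :=
        (tendsto_natCast_div_add_atTop (1 : ℝ)).pow 2
      rw [one_pow] at hratio
      filter_upwards [hratio.eventually_const_lt (inv_lt_one_of_one_lt₀ ha)] with k hk
      rw [div_pow, lt_div_iff₀ (by positivity), inv_mul_lt_iff₀ (by positivity)] at hk
      exact_mod_cast hk.le
    · refine (by simpa using h.add_const C : Tendsto _ _ (𝓝 C)).congr' ?_
      filter_upwards [eventually_ne_atTop 0] with k hk
      rw [hsplit, add_div, Nat.cast_pow, mul_div_assoc, div_self (by positivity), mul_one]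
  have hunshift := hshift.sub_const C
  rw [sub_self] at hunshift
  refine hunshift.congr' ?_
  filter_upwards [eventually_ne_atTop 0] with n hn
  rw [hsplit, add_div, mul_div_assoc, div_self (by positivity), mul_one, add_sub_cancel_right]

variable [IsProbabilityMeasure P] {U : ℕ → Ω → ℝ} {C : ℝ} {N : ℕ → Finset ℕ} {D : ℕ}

lemma integral_sq_sum_le (hU : ∀ i, AEStronglyMeasurable (U i) P)
    (hC : ∀ i, ∀ᵐ ω ∂P, |U i ω| ≤ C) (hN : ∀ i, (N i).card ≤ D)
    (huncorr : ∀ i, ∀ j ∉ N i, ∫ ω, U i ω * U j ω ∂P = 0) (n : ℕ) :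
    ∫ ω, (∑ i ∈ Finset.range n, U i ω) ^ 2 ∂P ≤ D * C ^ 2 * n := by
  have hbound (i j : ℕ) : ∀ᵐ ω ∂P, ‖U i ω * U j ω‖ ≤ C ^ 2 := by
    filter_upwards [hC i, hC j] with ω hi hj
    rw [norm_mul, sq]
    exact mul_le_mul hi hj (norm_nonneg _) ((abs_nonneg _).trans hi)
  have hint (i j : ℕ) : Integrable (fun ω => U i ω * U j ω) P :=
    .of_bound ((hU i).mul (hU j)) (C ^ 2) (hbound i j)
  have hcov (i j : ℕ) : ∫ ω, U i ω * U j ω ∂P ≤ if j ∈ N i then C ^ 2 else 0 := by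
    split_ifs with hj
    · exact (le_abs_self _).trans (by simpa using norm_integral_le_of_norm_le_const (hbound i j))
    · exact (huncorr i j hj).le
  calc ∫ ω, (∑ i ∈ Finset.range n, U i ω) ^ 2 ∂P
      = ∑ i ∈ Finset.range n, ∑ j ∈ Finset.range n, ∫ ω, U i ω * U j ω ∂P := by
        simp only [sq, Finset.sum_mul_sum]
        rw [integral_finsetSum _ fun i _ => integrable_finsetSum _ fun j _ => hint i j]
        exact Finset.sum_congr rfl fun i _ => integral_finsetSum _ fun j _ => hint i j
    _ ≤ ∑ i ∈ Finset.range n, D * C ^ 2 := Finset.sum_le_sum fun i _ => by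
        refine (Finset.sum_le_sum fun j _ => hcov i j).trans ?_
        rw [← Finset.sum_filter, Finset.sum_const, nsmul_eq_mul]
        gcongr
        exact (Finset.card_le_card fun j hj => (Finset.mem_filter.1 hj).2).trans (hN i)
    _ = D * C ^ 2 * n := by
        rw [Finset.sum_const, Finset.card_range, nsmul_eq_mul, mul_comm]

theorem ae_tendsto_average_zero_of_uncorrelated (hU : ∀ i, AEStronglyMeasurable (U i) P)
    (hC : ∀ i, ∀ᵐ ω ∂P, |U i ω| ≤ C) (hN : ∀ i, (N i).card ≤ D)
    (huncorr : ∀ i, ∀ j ∉ N i, ∫ ω, U i ω * U j ω ∂P = 0) :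
    ∀ᵐ ω ∂P, Tendsto (fun n : ℕ => (∑ i ∈ Finset.range n, U i ω) / n) atTop (𝓝 0) := by
  let Y (k : ℕ) (ω : Ω) : ℝ := ((∑ i ∈ Finset.range (k ^ 2), U i ω) / (k : ℝ) ^ 2) ^ 2
  have hYint (k : ℕ) : Integrable (Y k) P := by
    have hmem : MemLp (fun ω => ∑ i ∈ Finset.range (k ^ 2), U i ω) 2 P :=
      memLp_finsetSum _ fun i _ => .of_bound (hU i) C (hC i)
    simpa only [Y, div_pow] using hmem.integrable_sq.div_const (((k : ℝ) ^ 2) ^ 2)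
  have hYle (k : ℕ) : ∫ ω, Y k ω ∂P ≤ D * C ^ 2 * ((k : ℝ) ^ 2)⁻¹ := by
    rcases k.eq_zero_or_pos with rfl | hk
    · simp [Y]
    · simp only [Y, div_pow]
      rw [integral_div, div_le_iff₀ (by positivity)]
      refine (integral_sq_sum_le hU hC hN huncorr _).trans_eq ?_
      push_cast
      field_simp
  have hYsum : Summable fun k => ∫ ω, Y k ω ∂P :=
    .of_nonneg_of_le (fun k => integral_nonneg fun ω => sq_nonneg _) hYle
      ((Real.summable_nat_pow_inv.2 one_lt_two).mul_left _)
  filter_upwards [ae_all_iff.2 hC,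
    ae_tendsto_zero_of_summable_integral hYint (fun k ω => sq_nonneg _) hYsum] with ω hω hY
  refine tendsto_average_of_tendsto_average_sq hω (tendsto_zero_iff_abs_tendsto_zero _ |>.2 ?_)
  simpa [Y, Function.comp_def, Real.sqrt_sq_eq_abs] using hY.sqrt

end LawOfLargeNumbers

section Pattern

variable {Ω : Type*} [MeasurableSpace Ω] {P : Measure Ω} {𝓧 : Type*} [MeasurableSpace 𝓧]
  {L : Measure 𝓧} {α : Type*} {X : α → Ω → 𝓧} {κ : Type*}

lemma indepFun_pattern [Finite κ] (hX : iIndepFun X P) (hXm : ∀ i, AEMeasurable (X i) P)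
    {ψ : (κ → 𝓧) → ℝ} (hψ : Measurable ψ) {g g' : κ → α} (hgg' : ∀ w w', g w ≠ g' w') :
    IndepFun (fun ω => ψ fun w => X (g w) ω) (fun ω => ψ fun w => X (g' w) ω) P := by
  classical
  cases nonempty_fintype κ
  have hdisj : Disjoint (Finset.univ.image g) (Finset.univ.image g') := by
    simp only [Finset.disjoint_left, Finset.mem_image, Finset.mem_univ, true_and, not_exists]
    rintro _ ⟨w, rfl⟩ w' h
    exact hgg' w w' h.symm
  have hrestrict (g : κ → α) : Measurable fun a : ↥(Finset.univ.image g) → 𝓧 =>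
      ψ fun w => a ⟨g w, Finset.mem_image_of_mem g (Finset.mem_univ w)⟩ :=
    hψ.comp (measurable_pi_lambda _ fun w => measurable_pi_apply _)
  exact (hX.indepFun_finset₀ _ _ hdisj hXm).comp (hrestrict g) (hrestrict g')

theorem ae_tendsto_average_pattern_of_integral_eq_zero [Fintype κ] [IsProbabilityMeasure P]
    [IsProbabilityMeasure L] (hX : iIndepFun X P) (hXL : ∀ i, HasLaw (X i) L P)
    {ψ : (κ → 𝓧) → ℝ} (hψ : Measurable ψ) (hψ0 : ∫ a, ψ a ∂Measure.pi (fun _ => L) = 0)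
    {C : ℝ} (hC0 : 0 ≤ C) (hC : ∀ᵐ a ∂Measure.pi fun _ => L, |ψ a| ≤ C) {good : Set ℕ}
    {g : ℕ → κ → α} (hg : ∀ i ∈ good, (g i).Injective) {N : ℕ → Finset ℕ} {D : ℕ}
    (hN : ∀ i, (N i).card ≤ D)
    (hdisj : ∀ i ∈ good, ∀ j ∈ good, j ∉ N i → ∀ w w', g i w ≠ g j w') :
    ∀ᵐ ω ∂P, Tendsto (fun n : ℕ => (∑ i ∈ Finset.range n,
      good.indicator (fun i => ψ fun w => X (g i w) ω) i) / n) atTop (𝓝 0) := by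
  let U (i : ℕ) (ω : Ω) : ℝ := good.indicator (fun i => ψ fun w => X (g i w) ω) i
  have hU_of_mem {i : ℕ} (hi : i ∈ good) : U i = fun ω => ψ fun w => X (g i w) ω :=
    funext fun ω => Set.indicator_of_mem hi _
  have hU_of_notMem {i : ℕ} (hi : i ∉ good) : U i = 0 :=
    funext fun ω => Set.indicator_of_notMem hi _
  have hlaw {i : ℕ} (hi : i ∈ good) :
      HasLaw (fun ω w => X (g i w) ω) (Measure.pi fun _ => L) P :=
    (hX.precomp (hg i hi)).hasLaw_pi fun w => hXL (g i w)
  have hUmeas (i : ℕ) : AEStronglyMeasurable (U i) P := by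
    by_cases hi : i ∈ good
    · rw [hU_of_mem hi]
      exact (hψ.comp_aemeasurable (hlaw hi).aemeasurable).aestronglyMeasurable
    · rw [hU_of_notMem hi]
      exact aestronglyMeasurable_zero
  have hUbound (i : ℕ) : ∀ᵐ ω ∂P, |U i ω| ≤ C := by
    by_cases hi : i ∈ good
    · rw [hU_of_mem hi]
      exact (hlaw hi).ae_iff (measurableSet_le hψ.abs measurable_const).mem |>.2 hC
    · simp [hU_of_notMem hi, hC0]
  refine ae_tendsto_average_zero_of_uncorrelated hUmeas hUbound hN fun i j hij => ?_
  by_cases hi : i ∈ good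
  · by_cases hj : j ∈ good
    · have hindep : IndepFun (U i) (U j) P := by
        rw [hU_of_mem hi, hU_of_mem hj]
        exact indepFun_pattern hX (fun a => (hXL a).aemeasurable) hψ (hdisj i hi j hj hij)
      have hmean : ∫ ω, U i ω ∂P = 0 := by
        rw [hU_of_mem hi]
        exact ((hlaw hi).integral_comp hψ.aestronglyMeasurable).trans hψ0
      rw [hindep.integral_fun_mul_eq_mul_integral (hUmeas i) (hUmeas j), hmean, zero_mul]
    · simp [hj]
  · simp [hi]

theorem ae_tendsto_average_pattern [Fintype κ] [IsProbabilityMeasure P] [IsProbabilityMeasure L]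
    (hX : iIndepFun X P) (hXL : ∀ i, HasLaw (X i) L P) {ψ : (κ → 𝓧) → ℝ} (hψ : Measurable ψ)
    {C : ℝ} (hC : ∀ᵐ a ∂Measure.pi fun _ => L, |ψ a| ≤ C) {good : Set ℕ} {g : ℕ → κ → α}
    (hg : ∀ i ∈ good, (g i).Injective) {N : ℕ → Finset ℕ} {D : ℕ} (hN : ∀ i, (N i).card ≤ D)
    (hdisj : ∀ i ∈ good, ∀ j ∈ good, j ∉ N i → ∀ w w', g i w ≠ g j w') :
    ∀ᵐ ω ∂P, Tendsto (fun n : ℕ => (∑ i ∈ Finset.range n, good.indicator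
      (fun i => (ψ fun w => X (g i w) ω) - ∫ a, ψ a ∂Measure.pi fun _ => L) i) / n)
      atTop (𝓝 0) := by
  set m := ∫ a, ψ a ∂Measure.pi fun _ : κ => L
  have hm : |m| ≤ C := by
    simpa [m] using norm_integral_le_of_norm_le_const (f := ψ) hC
  have hC0 : 0 ≤ C := (abs_nonneg m).trans hm
  have hmean : ∫ a, (ψ a - m) ∂Measure.pi (fun _ : κ => L) = 0 := by
    rw [integral_sub (.of_bound hψ.aestronglyMeasurable C hC) (integrable_const m)]
    simp [m]
  exact ae_tendsto_average_pattern_of_integral_eq_zero hX hXL (hψ.sub_const m) hmean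
    (add_nonneg hC0 hC0) (hC.mono fun a ha => (abs_sub _ _).trans (add_le_add ha hm)) hg hN hdisj

end Pattern

/-! ### Enumerations of the grid -/

section Enumeration

variable {d : ℕ} {v : ℕ → Fin d → ℤ} {ρ n i j : ℕ} {w w' : Fin d → ℤ}

lemma IsGridEnumeration.image_range (hv : IsGridEnumeration v) {N : ℕ} (hN : 1 ≤ N) :
    (Finset.range (N ^ d)).image v = Finset.Icc (fun _ => 1) (fun _ => (N : ℤ)) := by
  apply Finset.coe_injective
  rw [Finset.coe_image, Finset.coe_range, Finset.coe_Icc]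
  refine (hv N hN).trans (Set.ext fun w => ?_)
  exact forall_and

lemma IsGridEnumeration.injective (hd : 0 < d) (hv : IsGridEnumeration v) : v.Injective := by
  intro i j hij
  let N := max i j + 1
  have hcard : ((Finset.range (N ^ d)).image v).card = (Finset.range (N ^ d)).card := by
    rw [hv.image_range (Nat.le_add_left 1 _), Pi.card_Icc]
    simp [N]
    norm_cast
  have hmem {l : ℕ} (hl : l < N) : l ∈ Finset.range (N ^ d) :=
    Finset.mem_range.2 (hl.trans_le (Nat.le_self_pow hd.ne' N))
  exact Finset.card_image_iff.1 hcard (hmem (by omega)) (hmem (by omega)) hij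

/-- The lattice points of the cube of radius `ρ` centred at the origin. -/
noncomputable abbrev latticeBox (d ρ : ℕ) : Finset (Fin d → ℤ) :=
  Finset.Icc (fun _ => -(ρ : ℤ)) (fun _ => (ρ : ℤ))

lemma mem_latticeBox : w ∈ latticeBox d ρ ↔ ‖w‖ ≤ ρ := by
  rw [pi_norm_le_iff_of_nonneg (Nat.cast_nonneg ρ), Finset.mem_Icc]
  simp only [Pi.le_def, Int.norm_eq_abs, ← forall_and, ← abs_le]
  norm_cast

/-- The indices below `n` of the sites around which the cube of radius `ρ` is not contained in
the first `n` sites. -/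
noncomputable def boundaryIndices (v : ℕ → Fin d → ℤ) (ρ n : ℕ) : Finset ℕ :=
  open Classical in
  (Finset.range n).filter fun i => ∃ w ∈ latticeBox d ρ, ∀ j < n, v j ≠ v i + w

lemma exists_apply_eq_add_of_notMem_boundaryIndices (hi : i < n) (hb : i ∉ boundaryIndices v ρ n)
    (hw : w ∈ latticeBox d ρ) : ∃ j < n, v j = v i + w := by
  by_contra! h
  exact hb (Finset.mem_filter.2 ⟨Finset.mem_range.2 hi, w, hw, h⟩)

lemma IsGridEnumeration.card_boundaryIndices_le (hd : 0 < d) (hv : IsGridEnumeration v) (ρ : ℕ)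
    {N : ℕ} (hN : 1 ≤ N) (hNn : N ^ d ≤ n) (hnN : n ≤ (N + 1) ^ d) :
    (boundaryIndices v ρ n).card ≤ (N + 1) ^ d - (N - 2 * ρ) ^ d := by
  let outer : Finset (Fin d → ℤ) := Finset.Icc (fun _ => 1) (fun _ => ((N + 1 : ℕ) : ℤ))
  let inner : Finset (Fin d → ℤ) := Finset.Icc (fun _ => (ρ + 1 : ℤ)) (fun _ => (N - ρ : ℤ))
  have hinner : inner ⊆ outer :=
    Finset.Icc_subset_Icc (fun _ => by simp) (fun _ => by push_cast; linarith)
  have hcard : (outer \ inner).card = (N + 1) ^ d - (N - 2 * ρ) ^ d := by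
    rw [Finset.card_sdiff_of_subset hinner, Pi.card_Icc, Pi.card_Icc]
    simp only [Int.card_Icc, Finset.prod_const, Finset.card_univ, Fintype.card_fin]
    congr 2 <;> omega
  rw [← hcard, ← Finset.card_image_of_injective _ (hv.injective hd)]
  refine Finset.card_le_card fun x hx => ?_
  obtain ⟨i, hi, rfl⟩ := Finset.mem_image.1 hx
  obtain ⟨hin, w, hw, hwn⟩ := Finset.mem_filter.1 hi
  refine Finset.mem_sdiff.2 ⟨?_, fun hvi => ?_⟩
  · have houter := hv.image_range (N := N + 1) (Nat.le_add_left 1 N)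
    change v i ∈ Finset.Icc _ _
    rw [← houter]
    exact Finset.mem_image_of_mem v
      (Finset.mem_range.2 ((Finset.mem_range.1 hin).trans_le hnN))
  · have hmem : v i + w ∈ (Finset.range (N ^ d)).image v := by
      rw [hv.image_range hN]
      simp only [inner, Finset.mem_Icc, Pi.le_def, Pi.add_apply] at hvi hw ⊢
      exact ⟨fun k => by linarith [hvi.1 k, hw.1 k], fun k => by linarith [hvi.2 k, hw.2 k]⟩
    obtain ⟨j, hj, hjw⟩ := Finset.mem_image.1 hmem
    exact hwn j ((Finset.mem_range.1 hj).trans_le hNn) hjw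

lemma tendsto_nthRoot_atTop (hd : d ≠ 0) : Tendsto (Nat.nthRoot d) atTop atTop := by
  refine tendsto_atTop.2 fun N => ?_
  filter_upwards [eventually_ge_atTop (N ^ d)] with n hn
  exact Nat.lt_succ_iff.1 (lt_of_pow_lt_pow_left₀ d (Nat.zero_le _)
    (hn.trans_lt (Nat.lt_pow_nthRoot_add_one hd n)))

lemma IsGridEnumeration.tendsto_card_boundaryIndices (hd : 0 < d) (hv : IsGridEnumeration v)
    (ρ : ℕ) : Tendsto (fun n : ℕ => ((boundaryIndices v ρ n).card : ℝ) / n) atTop (𝓝 0) := by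
  have hlim : Tendsto (fun N : ℕ => (1 + 1 / (N : ℝ)) ^ d - (1 - 2 * ρ / (N : ℝ)) ^ d) atTop
      (𝓝 0) := by
    have hadd := (tendsto_const_div_atTop_nhds_zero_nat (1 : ℝ)).const_add 1
    have hsub := (tendsto_const_div_atTop_nhds_zero_nat (2 * ρ : ℝ)).const_sub 1
    simpa using (hadd.pow d).sub (hsub.pow d)
  have hroot := tendsto_nthRoot_atTop hd.ne'
  refine squeeze_zero' (.of_forall fun n => by positivity) ?_ (hlim.comp hroot)
  filter_upwards [hroot.eventually_ge_atTop 1, hroot.eventually_ge_atTop (2 * ρ)] with n hN hρ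
  have hNn : Nat.nthRoot d n ^ d ≤ n := Nat.pow_nthRoot_le (.inl hd.ne')
  have hnN : n ≤ (Nat.nthRoot d n + 1) ^ d := (Nat.lt_pow_nthRoot_add_one hd.ne' n).le
  have hcard := hv.card_boundaryIndices_le hd ρ hN hNn hnN
  simp only [Function.comp_apply]
  generalize Nat.nthRoot d n = N at *
  have hN₀ : (0 : ℝ) < N := by exact_mod_cast hN
  have hpow : (N - 2 * ρ) ^ d ≤ (N + 1) ^ d := Nat.pow_le_pow_left (by omega) d
  calc ((boundaryIndices v ρ n).card : ℝ) / n
      ≤ (((N + 1) ^ d - (N - 2 * ρ) ^ d : ℕ) : ℝ) / (N ^ d : ℕ) := by gcongr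
    _ = (1 + 1 / (N : ℝ)) ^ d - (1 - 2 * ρ / (N : ℝ)) ^ d := by
        rw [one_add_div hN₀.ne', one_sub_div hN₀.ne', div_pow, div_pow, ← sub_div]
        push_cast [Nat.cast_sub hpow, Nat.cast_sub hρ]
        rfl

/-- The index of the site `v i + w`. If there is no such site, this is the junk value of
`Function.invFun`. -/
noncomputable def neighbourIndex (v : ℕ → Fin d → ℤ) (i : ℕ) (w : Fin d → ℤ) : ℕ :=
  Function.invFun v (v i + w)

lemma neighbourIndex_eq (hinj : v.Injective) (h : v j = v i + w) : neighbourIndex v i w = j := by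
  rw [neighbourIndex, ← h]
  exact Function.leftInverse_invFun hinj j

lemma apply_neighbourIndex (h : v i + w ∈ Set.range v) : v (neighbourIndex v i w) = v i + w :=
  Function.invFun_eq h

/-- The indices of the sites around which the cube of radius `ρ` is contained in the grid. -/
def interiorIndices (v : ℕ → Fin d → ℤ) (ρ : ℕ) : Set ℕ :=
  {i | ∀ w ∈ latticeBox d ρ, v i + w ∈ Set.range v}

lemma mem_interiorIndices_of_notMem (hi : i < n) (hb : i ∉ boundaryIndices v ρ n) :
    i ∈ interiorIndices v ρ := fun _ hw =>
  have ⟨j, _, hj⟩ := exists_apply_eq_add_of_notMem_boundaryIndices hi hb hw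
  ⟨j, hj⟩

lemma injective_neighbourIndex (hi : i ∈ interiorIndices v ρ) :
    (fun w : latticeBox d ρ => neighbourIndex v i w).Injective := fun w w' h => by
  have hv := congrArg v h
  rw [apply_neighbourIndex (hi w w.2), apply_neighbourIndex (hi w' w'.2)] at hv
  exact Subtype.ext (add_left_cancel hv)

lemma neighbourIndex_ne (hinj : v.Injective) (hi : i ∈ interiorIndices v ρ)
    (hj : j ∈ interiorIndices v ρ)
    (hij : j ∉ (latticeBox d (2 * ρ)).image (neighbourIndex v i)) (hw : w ∈ latticeBox d ρ)
    (hw' : w' ∈ latticeBox d ρ) : neighbourIndex v i w ≠ neighbourIndex v j w' := fun h => by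
  have hv := congrArg v h
  rw [apply_neighbourIndex (hi w hw), apply_neighbourIndex (hj w' hw')] at hv
  refine hij (Finset.mem_image.2 ⟨w - w', ?_, neighbourIndex_eq hinj ?_⟩)
  · rw [mem_latticeBox] at hw hw' ⊢
    push_cast
    linarith [norm_sub_le w w']
  · rw [← add_sub_assoc, hv, add_sub_cancel_right]

end Enumeration

/-! ### Averages over the grid -/

section Averages

lemma average_le_of_sparse {n : ℕ} {t : Fin n → ℝ} {bad : Finset ℕ} {η B : ℝ} (hη : 0 ≤ η)
    (hB : 0 ≤ B) (hgood : ∀ i : Fin n, (i : ℕ) ∉ bad → t i ≤ η) (ht : ∀ i, t i ≤ B) :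
    (∑ i, t i) / n ≤ η + B * (bad.card / n) := by
  rcases n.eq_zero_or_pos with rfl | hn
  · simpa using hη
  have hterm (i : Fin n) : t i ≤ η + if (i : ℕ) ∈ bad then B else 0 := by
    split_ifs with hi
    · linarith [ht i]
    · linarith [hgood i hi]
  have hcard : (Finset.univ.filter fun i : Fin n => (i : ℕ) ∈ bad).card ≤ bad.card :=
    Finset.card_le_card_of_injOn (fun i => (i : ℕ)) (fun i hi => (Finset.mem_filter.1 hi).2)
      Fin.val_injective.injOn
  have hsum : ∑ i, t i ≤ n * η + bad.card * B := by
    refine (Finset.sum_le_sum fun i _ => hterm i).trans ?_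
    rw [Finset.sum_add_distrib, ← Finset.sum_filter, Finset.sum_const, Finset.sum_const,
      nsmul_eq_mul, nsmul_eq_mul, Finset.card_univ, Fintype.card_fin]
    gcongr
  rw [div_le_iff₀ (by positivity)]
  refine hsum.trans_eq ?_
  field_simp

variable {t : ∀ n : ℕ, Fin n → ℝ} {Z : ℕ → ℝ} {bad : ℕ → Finset ℕ} {m η B δ : ℝ}

lemma eventually_average_le (hbad : Tendsto (fun n : ℕ => ((bad n).card : ℝ) / n) atTop (𝓝 0))
    (hZ : Tendsto (fun n : ℕ => (∑ i : Fin n, Z i) / n) atTop (𝓝 m)) (hη : 0 ≤ η) (hB : 0 ≤ B)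
    (hgood : ∀ n, ∀ i : Fin n, (i : ℕ) ∉ bad n → t n i - Z i ≤ η)
    (ht : ∀ n, ∀ i : Fin n, t n i - Z i ≤ B) (hδ : 0 < δ) :
    ∀ᶠ n : ℕ in atTop, (∑ i, t n i) / n ≤ m + η + δ := by
  have hlim : Tendsto (fun n : ℕ => (∑ i : Fin n, Z i) / n + (η + B * ((bad n).card / n))) atTop
      (𝓝 (m + η)) := by
    simpa using hZ.add ((hbad.const_mul B).const_add η)
  filter_upwards [hlim.eventually_le_const (lt_add_of_pos_right _ hδ)] with n hn
  have havg := average_le_of_sparse hη hB (hgood n) (ht n)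
  rw [Finset.sum_sub_distrib, sub_div] at havg
  linarith

lemma eventually_le_average (hbad : Tendsto (fun n : ℕ => ((bad n).card : ℝ) / n) atTop (𝓝 0))
    (hZ : Tendsto (fun n : ℕ => (∑ i : Fin n, Z i) / n) atTop (𝓝 m)) (hη : 0 ≤ η) (hB : 0 ≤ B)
    (hgood : ∀ n, ∀ i : Fin n, (i : ℕ) ∉ bad n → Z i - t n i ≤ η)
    (ht : ∀ n, ∀ i : Fin n, Z i - t n i ≤ B) (hδ : 0 < δ) :
    ∀ᶠ n : ℕ in atTop, m - η - δ ≤ (∑ i, t n i) / n := by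
  have hZneg : Tendsto (fun n : ℕ => (∑ i : Fin n, -Z i) / n) atTop (𝓝 (-m)) := by
    simpa only [Finset.sum_neg_distrib, neg_div] using hZ.neg
  filter_upwards [eventually_average_le (t := fun n i => -t n i) (Z := fun i => -Z i) hbad hZneg hη
    hB (fun n i hi => by linarith [hgood n i hi]) (fun n i => by linarith [ht n i]) hδ] with n hn
  rw [Finset.sum_neg_distrib, neg_div] at hn
  linarith

lemma eventually_abs_average_sub_le
    (hbad : Tendsto (fun n : ℕ => ((bad n).card : ℝ) / n) atTop (𝓝 0))
    (hZ : Tendsto (fun n : ℕ => (∑ i : Fin n, Z i) / n) atTop (𝓝 m)) (hη : 0 ≤ η) (hB : 0 ≤ B)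
    (hgood : ∀ n, ∀ i : Fin n, (i : ℕ) ∉ bad n → |t n i - Z i| ≤ η)
    (ht : ∀ n, ∀ i : Fin n, |t n i - Z i| ≤ B) (hδ : 0 < δ) :
    ∀ᶠ n : ℕ in atTop, |(∑ i, t n i) / n - m| ≤ η + δ := by
  filter_upwards [
    eventually_average_le hbad hZ hη hB (fun n i hi => (abs_le.1 (hgood n i hi)).2)
      (fun n i => (abs_le.1 (ht n i)).2) hδ,
    eventually_le_average hbad hZ hη hB (fun n i hi => (abs_sub_le_iff.1 (hgood n i hi)).2)
      (fun n i => (abs_sub_le_iff.1 (ht n i)).2) hδ] with n hle hge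
  rw [abs_le]
  constructor <;> linarith

lemma tendsto_average_of_indicator {good : Set ℕ}
    (hbad : Tendsto (fun n : ℕ => ((bad n).card : ℝ) / n) atTop (𝓝 0))
    (hgood : ∀ n, ∀ i : Fin n, (i : ℕ) ∉ bad n → (i : ℕ) ∈ good) (hZ : ∀ i, |Z i| ≤ B)
    (h : Tendsto (fun n : ℕ => (∑ i ∈ Finset.range n, good.indicator (fun i => Z i - m) i) / n)
      atTop (𝓝 0)) :
    Tendsto (fun n : ℕ => (∑ i : Fin n, Z i) / n) atTop (𝓝 m) := by
  let U (i : ℕ) : ℝ := good.indicator (fun i => Z i - m) i + m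
  have hB : 0 ≤ B + |m| := add_nonneg ((abs_nonneg _).trans (hZ 0)) (abs_nonneg m)
  have hU : Tendsto (fun n : ℕ => (∑ i : Fin n, U i) / n) atTop (𝓝 m) := by
    have hadd := h.add_const m
    rw [zero_add] at hadd
    refine hadd.congr' ?_
    filter_upwards [eventually_ne_atTop 0] with n hn
    rw [Fin.sum_univ_eq_sum_range, Finset.sum_add_distrib, add_div]
    simp [hn]
  have hZU {i : ℕ} (hi : i ∈ good) : Z i - U i = 0 := by simp [U, hi]
  have hZU' (i : ℕ) : |Z i - U i| ≤ B + |m| := by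
    by_cases hi : i ∈ good
    · rwa [hZU hi, abs_zero]
    · simpa [U, hi] using (abs_sub _ _).trans (add_le_add_left (hZ i) |m|)
  refine Metric.tendsto_nhds.2 fun δ hδ => ?_
  filter_upwards [eventually_abs_average_sub_le (t := fun _ i => Z i) hbad hU le_rfl hB
    (fun n i hi => by rw [hZU (hgood n i hi), abs_zero]) (fun _ i => hZU' i) (half_pos hδ)]
    with n hn
  rw [Real.dist_eq]
  linarith

variable {A m η : ℕ → ℝ}

lemma cauchySeq_of_eventually_abs_sub_le (hη : Tendsto η atTop (𝓝 0))
    (h : ∀ ρ, ∀ δ > 0, ∀ᶠ n in atTop, |A n - m ρ| ≤ η ρ + δ) : CauchySeq m := by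
  have hclose (ρ ρ' : ℕ) : |m ρ - m ρ'| ≤ η ρ + η ρ' := by
    refine le_of_forall_pos_le_add fun δ hδ => ?_
    obtain ⟨n, hn, hn'⟩ := ((h ρ (δ / 2) (half_pos hδ)).and (h ρ' (δ / 2) (half_pos hδ))).exists
    rw [abs_sub_comm] at hn
    linarith [abs_sub_le (m ρ) (A n) (m ρ')]
  refine Metric.cauchySeq_iff.2 fun δ hδ => ?_
  obtain ⟨ρ₀, hρ₀⟩ := eventually_atTop.1 (hη.eventually_lt_const (half_pos hδ))
  refine ⟨ρ₀, fun ρ hρ ρ' hρ' => ?_⟩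
  rw [Real.dist_eq]
  linarith [hclose ρ ρ', hρ₀ ρ hρ, hρ₀ ρ' hρ']

lemma tendsto_of_eventually_abs_sub_le {s : ℝ} (hη : Tendsto η atTop (𝓝 0))
    (hm : Tendsto m atTop (𝓝 s)) (h : ∀ ρ, ∀ δ > 0, ∀ᶠ n in atTop, |A n - m ρ| ≤ η ρ + δ) :
    Tendsto A atTop (𝓝 s) := by
  refine Metric.tendsto_nhds.2 fun δ hδ => ?_
  obtain ⟨ρ, hηρ, hmρ⟩ := ((hη.eventually_lt_const (by positivity : 0 < δ / 4)).and
    (Metric.tendsto_nhds.1 hm (δ / 4) (by positivity))).exists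
  filter_upwards [h ρ (δ / 4) (by positivity)] with n hn
  rw [Real.dist_eq] at hmρ ⊢
  linarith [abs_sub_le (A n) (m ρ) s]

end Averages

section LocalAverages

variable {d : ℕ} {v : ℕ → Fin d → ℤ} {ρ : ℕ} {Ω : Type*} [MeasurableSpace Ω] {P : Measure Ω}
  {𝓧 : Type*} [MeasurableSpace 𝓧] {L : Measure 𝓧} {X : ℕ → Ω → 𝓧} {S : Set 𝓧} {B : ℝ}

theorem IsGridEnumeration.ae_tendsto_average_local [IsProbabilityMeasure L] (hd : 0 < d)
    (hv : IsGridEnumeration v) (hX : iIndepFun X P) (hXL : ∀ i, HasLaw (X i) L P)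
    (hS : ∀ᵐ x ∂L, x ∈ S) {ψ : (latticeBox d ρ → 𝓧) → ℝ} (hψ : Measurable ψ)
    (hB : ∀ z, (∀ w, z w ∈ S) → |ψ z| ≤ B) :
    ∀ᵐ ω ∂P, Tendsto (fun n : ℕ => (∑ i : Fin n, ψ fun w => X (neighbourIndex v i w) ω) / n)
      atTop (𝓝 (∫ a, ψ a ∂Measure.pi fun _ => L)) := by
  have := (hXL 0).isProbabilityMeasure
  have hψB : ∀ᵐ a ∂Measure.pi fun _ : latticeBox d ρ => L, |ψ a| ≤ B := by
    filter_upwards [ae_all_iff.2 fun w => (Measure.quasiMeasurePreserving_eval _ w).ae hS]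
      with a ha using hB a ha
  have hXS (i : ℕ) : ∀ᵐ ω ∂P, X i ω ∈ S :=
    ae_of_ae_map (hXL i).aemeasurable ((hXL i).map_eq ▸ hS)
  have hcentred := ae_tendsto_average_pattern hX hXL hψ hψB (good := interiorIndices v ρ)
    (g := fun i w => neighbourIndex v i w) (fun i hi => injective_neighbourIndex hi)
    (N := fun i => (latticeBox d (2 * ρ)).image (neighbourIndex v i))
    (fun i => Finset.card_image_le)
    fun i hi j hj hij w w' => neighbourIndex_ne (hv.injective hd) hi hj hij w.2 w'.2
  filter_upwards [hcentred, ae_all_iff.2 hXS] with ω hU hω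
  have hZ (i : ℕ) : |ψ fun w => X (neighbourIndex v i w) ω| ≤ B := hB _ fun _ => hω _
  exact tendsto_average_of_indicator (Z := fun i => ψ fun w => X (neighbourIndex v i w) ω)
    (hv.tendsto_card_boundaryIndices hd ρ)
    (fun n i hi => mem_interiorIndices_of_notMem i.2 hi) hZ hU

end LocalAverages

/-! ### Kernels with polynomial decay -/

section Decay

variable {d : ℕ} {E ι κ : Type*} [SeminormedAddCommGroup E] {δ c C ρ : ℝ} {k kA kB : E → ℝ}
  {u : ι → Fin d → ℤ} {y : ι → E}

/-- The kernel `k` decays polynomially at the order `d + 1`, which makes it summable along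
separated configurations labelled by `d`-dimensional lattice points. -/
def HasDecay (d : ℕ) (C : ℝ) (k : E → ℝ) : Prop :=
  ∀ t, |k t| ≤ C / (1 + ‖t‖ ^ (d + 1))

/-- The majorant, as a function of the difference of labels, of the matrix of a kernel with
polynomial decay on a `δ`-separated configuration. -/
noncomputable def latticeMajorant (d : ℕ) (δ C : ℝ) (w : Fin d → ℤ) : ℝ :=
  C / (1 + (δ * ‖w‖) ^ (d + 1))

lemma HasDecay.abs_le (hk : HasDecay d C k) (t : E) : |k t| ≤ C := by
  have hC : 0 ≤ C := by simpa using (abs_nonneg _).trans (hk 0)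
  exact (hk t).trans (div_le_self hC (le_add_of_nonneg_right (by positivity)))

lemma HasDecay.nonneg (hk : HasDecay d C k) : 0 ≤ C :=
  (abs_nonneg _).trans (hk.abs_le 0)

lemma HasDecay.mono {C' : ℝ} (hk : HasDecay d C k) (hC : C ≤ C') : HasDecay d C' k := fun t =>
  (hk t).trans (div_le_div_of_nonneg_right hC (by positivity))

lemma latticeMajorant_nonneg (hδ : 0 ≤ δ) (hC : 0 ≤ C) (w : Fin d → ℤ) :
    0 ≤ latticeMajorant d δ C w := by
  rw [latticeMajorant]
  positivity

lemma summable_latticeMajorant (hδ : 0 < δ) (C : ℝ) : Summable (latticeMajorant d δ C) := by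
  unfold latticeMajorant
  refine Summable.mul_left C (.of_norm_bounded_eventually
    ((summable_norm_pow_inv d).mul_left (δ ^ (d + 1))⁻¹) ?_)
  refine (Set.finite_singleton (0 : Fin d → ℤ)).subset fun w hw => ?_
  by_contra hw₀
  have : 0 < ‖w‖ := norm_pos_iff.2 hw₀
  refine hw ?_
  rw [Set.mem_ofPred_eq, norm_inv, Real.norm_of_nonneg (by positivity), ← mul_inv, ← mul_pow]
  gcongr
  exact le_add_of_nonneg_left zero_le_one

lemma HasDecay.abs_kernelMatrix_le (hk : HasDecay d C k) (hδ : 0 ≤ δ) (hy : IsSeparated δ u y)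
    (i j : ι) : |kernelMatrix k y i j| ≤ latticeMajorant d δ C (u i - u j) := by
  refine (hk _).trans (div_le_div_of_nonneg_left hk.nonneg (by positivity) ?_)
  gcongr
  exact hy.le_norm_sub i j

/-- The error made by computing a diagonal entry of `R⁻¹ A R⁻¹ B` from the points with labels at
distance at most `ρ`, when the matrices come from kernels bounded by `C / (1 + ‖t‖ ^ (d + 1))` at a
`δ`-separated configuration and `c • 1 ≤ R`. -/
noncomputable def localityError (d : ℕ) (δ c C ρ : ℝ) : ℝ :=
  sandwichModulus c (∑' w, latticeMajorant d δ C w) * commutatorModulus (latticeMajorant d δ C) ρ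

lemma localityError_nonneg (hδ : 0 ≤ δ) (hc : 0 ≤ c) (hC : 0 ≤ C) (hρ : 0 ≤ ρ) :
    0 ≤ localityError d δ c C ρ := by
  have hW : 0 ≤ ∑' w, latticeMajorant d δ C w := tsum_nonneg (latticeMajorant_nonneg hδ hC)
  refine mul_nonneg ?_ (tsum_nonneg fun w =>
    mul_nonneg (latticeMajorant_nonneg hδ hC w) (le_min zero_le_one (by positivity)))
  rw [sandwichModulus]
  positivity

lemma tendsto_localityError (hδ : 0 < δ) (hC : 0 ≤ C) :
    Tendsto (localityError d δ c C) atTop (𝓝 0) := by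
  unfold localityError
  simpa only [mul_zero] using (tendsto_commutatorModulus (latticeMajorant_nonneg hδ.le hC)
    (summable_latticeMajorant hδ C)).const_mul (sandwichModulus c _)

variable [Fintype ι] [DecidableEq ι]

lemma HasDecay.norm_kernelMatrix_le (hk : HasDecay d C k) (hδ : 0 < δ) (hy : IsSeparated δ u y) :
    ‖kernelMatrix k y‖ ≤ ∑' w, latticeMajorant d δ C w :=
  l2_opNorm_le_tsum (latticeMajorant_nonneg hδ.le hk.nonneg) (summable_latticeMajorant hδ C)
    hy.injective (hk.abs_kernelMatrix_le hδ.le hy)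

/-- The product `R⁻¹ A R⁻¹ B` for the matrices `R`, `A` and `B` of three kernels at the points
`y i`. -/
noncomputable def kernelSandwich (k kA kB : E → ℝ) (y : ι → E) : Matrix ι ι ℝ :=
  sandwich (kernelMatrix k y) (kernelMatrix kA y) (kernelMatrix kB y)

lemma abs_kernelSandwich_apply_le (hc : 0 < c) (hcoer : c • 1 ≤ kernelMatrix k y) (hδ : 0 < δ)
    (hA : HasDecay d C kA) (hB : HasDecay d C kB) (hy : IsSeparated δ u y) (i : ι) :
    |kernelSandwich k kA kB y i i| ≤ sandwichBound c (∑' w, latticeMajorant d δ C w) :=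
  abs_sandwich_apply_le hc hcoer (hA.norm_kernelMatrix_le hδ hy) (hB.norm_kernelMatrix_le hδ hy) i

lemma abs_kernelSandwich_apply_sub_le [Fintype κ] [DecidableEq κ] (hc : 0 < c)
    (hcoer : c • 1 ≤ kernelMatrix k y) (hδ : 0 < δ) (hk : HasDecay d C k) (hA : HasDecay d C kA)
    (hB : HasDecay d C kB) (hy : IsSeparated δ u y) (hρ : 0 < ρ) {e : κ → ι} (he : e.Injective)
    {l : κ} (hfar : ∀ i ∉ Set.range e, ρ ≤ ‖u i - u (e l)‖) :
    |kernelSandwich k kA kB y (e l) (e l) - kernelSandwich k kA kB (y ∘ e) l l| ≤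
      localityError d δ c C ρ := by
  have hcomm {h : E → ℝ} (hh : HasDecay d C h) := norm_commutator_cutoff_le (a := u (e l))
    (latticeMajorant_nonneg hδ.le hh.nonneg) (summable_latticeMajorant hδ C) hy.injective hρ
    (hh.abs_kernelMatrix_le hδ.le hy)
  exact abs_sandwich_apply_sub_le he
    (fun i hi => by rw [cutoff_eq_one hρ (hfar i hi), abs_one]) hc hcoer
    (hk.norm_kernelMatrix_le hδ hy) (hA.norm_kernelMatrix_le hδ hy) (hB.norm_kernelMatrix_le hδ hy)
    (hcomm hk) (hcomm hA) (hcomm hB) (cutoff_self (e l))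

end Decay

section Measurability

variable {α E ι : Type*} [Fintype ι] [DecidableEq ι] [SeminormedAddCommGroup E] {k kA kB : E → ℝ}

omit [Fintype ι] [DecidableEq ι] in
lemma continuous_kernelMatrix [TopologicalSpace α] {y : α → ι → E} (hk : Continuous k)
    (hy : Continuous y) : Continuous fun a => kernelMatrix k (y a) :=
  continuous_matrix fun i j =>
    hk.comp (((continuous_apply i).comp hy).sub ((continuous_apply j).comp hy))

variable [MeasurableSpace α]

omit [DecidableEq ι] in
lemma measurable_mul_apply {M N : α → Matrix ι ι ℝ} (hM : ∀ i j, Measurable fun a => M a i j)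
    (hN : ∀ i j, Measurable fun a => N a i j) (i j : ι) : Measurable fun a => (M a * N a) i j := by
  simp only [Matrix.mul_apply]
  exact Finset.measurable_fun_sum _ fun l _ => (hM i l).mul (hN l j)

variable [TopologicalSpace α] [OpensMeasurableSpace α]

lemma measurable_inv_apply {M : α → Matrix ι ι ℝ} (hM : Continuous M) (i j : ι) :
    Measurable fun a => (M a)⁻¹ i j := by
  simp only [Matrix.inv_def, Matrix.smul_apply, Ring.inverse_eq_inv', smul_eq_mul]
  exact hM.matrix_det.measurable.inv.mul (hM.matrix_adjugate.matrix_elem i j).measurable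

lemma measurable_kernelSandwich_apply {y : α → ι → E} (hk : Continuous k) (hA : Continuous kA)
    (hB : Continuous kB) (hy : Continuous y) (i j : ι) :
    Measurable fun a => kernelSandwich k kA kB (y a) i j := by
  have hinv := measurable_inv_apply (continuous_kernelMatrix hk hy)
  have hentry {h : E → ℝ} (hh : Continuous h) (i j : ι) :
      Measurable fun a => kernelMatrix h (y a) i j :=
    ((continuous_kernelMatrix hh hy).matrix_elem i j).measurable
  exact measurable_mul_apply
    (measurable_mul_apply (measurable_mul_apply hinv (hentry hA)) hinv) (hentry hB) i j

end Measurability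

/-! ### Perturbed lattices -/

section PerturbedLattice

variable {d : ℕ} {ι : Type*} {u : ι → Fin d → ℤ} {z : ι → EuclideanSpace ℝ (Fin d)} {ε : ℝ}

/-- The cube `[-1, 1]^d`. -/
def unitCube (d : ℕ) : Set (EuclideanSpace ℝ (Fin d)) :=
  {x | ∀ k, |x k| ≤ 1}

/-- The lattice points `u i` displaced by `ε • z i`. -/
noncomputable def perturbedLattice (ε : ℝ) (u : ι → Fin d → ℤ) (z : ι → EuclideanSpace ℝ (Fin d))
    (i : ι) : EuclideanSpace ℝ (Fin d) :=
  latticePoint (u i) + ε • z i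

lemma latticePoint_add (w w' : Fin d → ℤ) :
    latticePoint (w + w') = latticePoint w + latticePoint w' := by
  ext k
  simp [latticePoint]

lemma latticePoint_zero : latticePoint (0 : Fin d → ℤ) = 0 := by
  ext k
  simp [latticePoint]

lemma perturbedLattice_sub (ε : ℝ) (u : ι → Fin d → ℤ) (z : ι → EuclideanSpace ℝ (Fin d))
    (i j : ι) : perturbedLattice ε u z i - perturbedLattice ε u z j =
      latticePoint (u i - u j) + ε • (z i - z j) := by
  rw [perturbedLattice, perturbedLattice, smul_sub, add_sub_add_comm, ← sub_add_cancel (u i) (u j),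
    latticePoint_add, sub_add_cancel, add_sub_cancel_right]

lemma continuous_perturbedLattice (ε : ℝ) (u : ι → Fin d → ℤ) :
    Continuous (perturbedLattice ε u) :=
  continuous_pi fun i => continuous_const.add ((continuous_apply i).const_smul ε)

lemma le_norm_latticePoint_add_smul_sub {x x' : EuclideanSpace ℝ (Fin d)} (hx : x ∈ unitCube d)
    (hx' : x' ∈ unitCube d) (ε : ℝ) (w : Fin d → ℤ) :
    (1 - 2 * |ε|) * ‖w‖ ≤ ‖latticePoint w + ε • (x - x')‖ := by
  rcases eq_or_ne w 0 with rfl | hw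
  · rw [norm_zero, mul_zero]
    exact norm_nonneg _
  have one_le_norm : 1 ≤ ‖w‖ := by
    obtain ⟨k, hk⟩ := Function.ne_iff.1 hw
    refine le_trans ?_ (norm_le_pi_norm w k)
    rw [Int.norm_eq_abs]
    exact_mod_cast Int.one_le_abs hk
  suffices ‖w‖ ≤ ‖latticePoint w + ε • (x - x')‖ + 2 * |ε| by nlinarith [abs_nonneg ε]
  refine (pi_norm_le_iff_of_nonneg (by positivity)).2 fun k => ?_
  have hdisp : |ε * (x k - x' k)| ≤ 2 * |ε| := by
    rw [abs_mul, mul_comm 2]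
    gcongr
    linarith [abs_sub (x k) (x' k), hx k, hx' k]
  calc ‖w k‖ = |(latticePoint w + ε • (x - x')) k - ε * (x k - x' k)| := by
        simp [latticePoint, Int.norm_eq_abs]
    _ ≤ |(latticePoint w + ε • (x - x')) k| + |ε * (x k - x' k)| := abs_sub _ _
    _ ≤ ‖latticePoint w + ε • (x - x')‖ + 2 * |ε| :=
        add_le_add (PiLp.norm_apply_le (latticePoint w + ε • (x - x')) k) hdisp

lemma isSeparated_perturbedLattice (hu : u.Injective) (hz : ∀ i, z i ∈ unitCube d) (ε : ℝ) :
    IsSeparated (1 - 2 * |ε|) u (perturbedLattice ε u z) where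
  injective := hu
  le_norm_sub i j := by
    rw [perturbedLattice_sub]
    exact le_norm_latticePoint_add_smul_sub (hz i) (hz j) ε _

lemma kernelMatrix_perturbedLattice_add (k : EuclideanSpace ℝ (Fin d) → ℝ) (ε : ℝ)
    (a : Fin d → ℤ) (u : ι → Fin d → ℤ) (z : ι → EuclideanSpace ℝ (Fin d)) :
    kernelMatrix k (perturbedLattice ε (fun i => a + u i) z) =
      kernelMatrix k (perturbedLattice ε u z) := by
  ext i j
  simp only [kernelMatrix_apply, perturbedLattice_sub, add_sub_add_left_eq_sub]

/-- The first `n` points of the grid enumerated by `v`, displaced by the perturbations `x`. -/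
noncomputable def perturbedGrid (v : ℕ → Fin d → ℤ) (ε : ℝ) (x : ℕ → EuclideanSpace ℝ (Fin d))
    (n : ℕ) : Fin n → EuclideanSpace ℝ (Fin d) :=
  perturbedLattice ε (fun i : Fin n => v i) fun i => x i

lemma isSeparated_perturbedGrid {v : ℕ → Fin d → ℤ} (hv : v.Injective)
    {x : ℕ → EuclideanSpace ℝ (Fin d)} (hx : ∀ i, x i ∈ unitCube d) (ε : ℝ) (n : ℕ) :
    IsSeparated (1 - 2 * |ε|) (fun i : Fin n => v i) (perturbedGrid v ε x n) :=
  isSeparated_perturbedLattice (hv.comp Fin.val_injective) (fun i => hx i) ε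

end PerturbedLattice

/-! ### Regular covariance models -/

section DifferenceQuotient

variable {f f' f'' : ℝ → ℝ} {C r s : ℝ}

lemma abs_sub_le_of_hasDerivAt_of_bounded (hf : ∀ x, |x| < r → HasDerivAt f (f' x) x)
    (hC : ∀ x, |x| < r → |f' x| ≤ C) (hs : |s| < r) : |f s - f 0| ≤ C * |s| := by
  have hsub {x : ℝ} (hx : x ∈ Metric.ball 0 r) : |x| < r := by simpa using hx
  simpa using (convex_ball (0 : ℝ) r).norm_image_sub_le_of_norm_hasDerivWithin_le
    (fun x hx => (hf x (hsub hx)).hasDerivWithinAt) (fun x hx => hC x (hsub hx))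
    (Metric.mem_ball_self ((abs_nonneg s).trans_lt hs)) (by simpa using hs)

lemma abs_diffQuot_sub_deriv_le (hf : ∀ x, |x| < r → HasDerivAt f (f' x) x)
    (hf' : ∀ x, |x| < r → HasDerivAt f' (f'' x) x) (hC : ∀ x, |x| < r → |f'' x| ≤ C)
    (hs : |s| < r) (hs₀ : s ≠ 0) : |s⁻¹ * (f s - f 0) - f' 0| ≤ C * |s| := by
  have hC₀ : 0 ≤ C := (abs_nonneg _).trans (hC s hs)
  have hsub {x : ℝ} (hx : x ∈ Metric.closedBall 0 |s|) : |x| ≤ |s| := by simpa using hx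
  have hremainder : |f s - s * f' 0 - f 0| ≤ C * |s| * |s| := by
    simpa using (convex_closedBall (0 : ℝ) |s|).norm_image_sub_le_of_norm_hasDerivWithin_le
      (f := fun x => f x - x * f' 0) (f' := fun x => f' x - f' 0) (C := C * |s|)
      (fun x hx => ((hf x ((hsub hx).trans_lt hs)).sub
        (by simpa using (hasDerivAt_id x).mul_const (f' 0))).hasDerivWithinAt)
      (fun x hx => (abs_sub_le_of_hasDerivAt_of_bounded hf' hC ((hsub hx).trans_lt hs)).trans
        (mul_le_mul_of_nonneg_left (hsub hx) hC₀))
      (Metric.mem_closedBall_self (abs_nonneg s)) (y := s) (by simp)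
  have hquot : s⁻¹ * (f s - f 0) - f' 0 = s⁻¹ * (f s - s * f' 0 - f 0) := by
    field_simp
    ring
  rwa [hquot, abs_mul, abs_inv, inv_mul_le_iff₀ (abs_pos.2 hs₀), mul_comm |s|]

lemma continuous_of_abs_diffQuot_sub_le {T : Type*} [TopologicalSpace T] {F : ℝ → T → ℝ}
    {D : T → ℝ} (hr : 0 < r) (hF : ∀ s, |s| < r → Continuous (F s))
    (hD : ∀ s, |s| < r → s ≠ 0 → ∀ t, |s⁻¹ * (F s t - F 0 t) - D t| ≤ C * |s|) :
    Continuous D := by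
  have hsmall : ∀ᶠ s in 𝓝[≠] (0 : ℝ), |s| < r ∧ s ≠ 0 :=
    (((continuous_abs.tendsto 0).eventually_lt_const (by simpa)).filter_mono
      nhdsWithin_le_nhds).and eventually_mem_nhdsWithin
  have hlim : Tendsto (fun s : ℝ => C * |s|) (𝓝[≠] 0) (𝓝 0) := by
    simpa using ((continuous_abs.tendsto (0 : ℝ)).const_mul C).mono_left nhdsWithin_le_nhds
  have hunif : TendstoUniformly (fun s t => s⁻¹ * (F s t - F 0 t)) D (𝓝[≠] 0) := by
    refine Metric.tendstoUniformly_iff.2 fun δ hδ => ?_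
    filter_upwards [hsmall, hlim.eventually_lt_const hδ] with s hs hsδ t
    rw [dist_comm]
    exact (hD s hs.1 hs.2 t).trans_lt hsδ
  refine hunif.continuous (hsmall.mono fun s hs => ?_).frequently
  exact continuous_const.mul ((hF s hs.1).sub (hF 0 (by simpa)))

end DifferenceQuotient

section Model

variable {d p : ℕ} {Θ : Set (Fin p → ℝ)} {K : (Fin p → ℝ) → EuclideanSpace ℝ (Fin d) → ℝ}
  {θ θ₀ : Fin p → ℝ}

lemma paramBox_mem_nhds {a b : ℝ} (hθ : ∀ i, a < θ i ∧ θ i < b) : paramBox p a b ∈ 𝓝 θ :=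
  pi_Icc_mem_nhds' (fun i => (hθ i).1) fun i => (hθ i).2

lemma hasDerivAt_partialWithin {F : (Fin p → ℝ) → ℝ} (hF : DifferentiableOn ℝ F Θ) {i : Fin p}
    {s : ℝ} (hs : Θ ∈ 𝓝 (θ + s • Pi.single i (1 : ℝ))) :
    HasDerivAt (fun r : ℝ => F (θ + r • Pi.single i (1 : ℝ)))
      (partialWithin Θ i F (θ + s • Pi.single i (1 : ℝ))) s := by
  have hdiff := (hF _ (mem_of_mem_nhds hs)).differentiableAt hs
  rw [partialWithin, lineDerivWithin_of_mem_nhds hs, hdiff.lineDeriv_eq_fderiv]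
  refine hdiff.hasFDerivAt.comp_hasDerivAt s ?_
  simpa using ((hasDerivAt_id s).smul_const (Pi.single i (1 : ℝ) : Fin p → ℝ)).const_add θ

/-- The kernel `t ↦ ∂K_θ(t)/∂θ_i`. -/
noncomputable def kernelPartial (Θ : Set (Fin p → ℝ))
    (K : (Fin p → ℝ) → EuclideanSpace ℝ (Fin d) → ℝ) (θ : Fin p → ℝ) (i : Fin p)
    (t : EuclideanSpace ℝ (Fin d)) : ℝ :=
  partialWithin Θ i (fun θ' => K θ' t) θ

namespace IsRegularModel

lemma eq_cosTransform (hK : IsRegularModel Θ K) (hθ : θ ∈ Θ) :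
    K θ = cosTransform fun f => (fourierHat (K θ) f).re := by
  ext t
  have hint : Integrable fun f : EuclideanSpace ℝ (Fin d) =>
      fourierHat (K θ) f * Complex.exp (Complex.I * (inner ℝ f t : ℝ)) := by
    refine (hK.integrable_hat θ hθ).mul_bdd (c := 1)
      (Continuous.aestronglyMeasurable (by fun_prop)) (ae_of_all _ fun f => ?_)
    rw [mul_comm, Complex.norm_exp_ofReal_mul_I]
  rw [← Complex.ofReal_re (K θ t), hK.inversion θ hθ t]
  refine (integral_re hint).symm.trans (integral_congr_ae (ae_of_all _ fun f => ?_))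
  simp only [RCLike.re_to_complex]
  rw [Complex.mul_re, hK.hat_real θ hθ f, zero_mul, sub_zero, mul_comm Complex.I,
    Complex.exp_ofReal_mul_I_re]

lemma continuous (hK : IsRegularModel Θ K) (hθ : θ ∈ Θ) : Continuous (K θ) := by
  rw [hK.eq_cosTransform hθ]
  exact continuous_cosTransform (hK.integrable_hat θ hθ).re

lemma exists_isUniformlyCoercive (hK : IsRegularModel Θ K) (hθ : θ ∈ Θ) {δ : ℝ} (hδ : 0 < δ) :
    ∃ c, 0 < c ∧ IsUniformlyCoercive d δ c (K θ) := by
  have hcont : Continuous (fourierHat (K θ)) := continuousOn_univ.1 <|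
    hK.continuous_hat.comp (f := fun f => (f, θ)) (by fun_prop) fun f _ => ⟨trivial, hθ⟩
  rw [hK.eq_cosTransform hθ]
  exact exists_isUniformlyCoercive_cosTransform (hK.integrable_hat θ hθ).re
    (Complex.continuous_re.comp hcont) (hK.hat_pos θ hθ) hδ

lemma continuous_kernelPartial (hK : IsRegularModel Θ K) (hΘ : Θ ∈ 𝓝 θ₀) (i : Fin p) :
    Continuous (kernelPartial Θ K θ₀ i) := by
  let path : ℝ → Fin p → ℝ := fun s => θ₀ + s • Pi.single i 1
  have hpath : Tendsto path (𝓝 0) (𝓝 θ₀) := by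
    have : Continuous path := by fun_prop
    simpa [path] using this.tendsto 0
  obtain ⟨r, hr, hball⟩ := Metric.mem_nhds_iff.1
    (hpath.eventually (eventually_mem_nhds_iff.2 hΘ))
  have hmem (s : ℝ) (hs : |s| < r) : Θ ∈ 𝓝 (path s) := hball (by simpa [Real.dist_eq] using hs)
  obtain ⟨C, hC⟩ := hK.decay [i, i] (by simp)
  have hbound (s : ℝ) (hs : |s| < r) (t : EuclideanSpace ℝ (Fin d)) :
      |partialWithin Θ i (partialWithin Θ i fun θ => K θ t) (path s)| ≤ C :=
    HasDecay.abs_le (hC _ (mem_of_mem_nhds (hmem s hs))) t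
  refine continuous_of_abs_diffQuot_sub_le (F := fun s => K (path s)) (C := C) hr
    (fun s hs => hK.continuous (mem_of_mem_nhds (hmem s hs))) fun s hs hs₀ t => ?_
  have hquot := abs_diffQuot_sub_deriv_le
    (fun x hx => hasDerivAt_partialWithin (hK.differentiable [] (by simp) t) (hmem x hx))
    (fun x hx => hasDerivAt_partialWithin (hK.differentiable [i] (by simp) t) (hmem x hx))
    (fun x hx => hbound x hx t) hs hs₀
  simpa [path, iterPartialWithin, kernelPartial] using hquot

lemma kernelPartial_neg (hK : IsRegularModel Θ K) (hθ : θ ∈ Θ) (i : Fin p)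
    (t : EuclideanSpace ℝ (Fin d)) : kernelPartial Θ K θ i (-t) = kernelPartial Θ K θ i t :=
  lineDerivWithin_congr (fun θ' hθ' => (hK.covariance θ' hθ').symm t)
    ((hK.covariance θ hθ).symm t)

lemma exists_hasDecay (hK : IsRegularModel Θ K) (hθ : θ ∈ Θ) :
    ∃ C, HasDecay d C (K θ) ∧ ∀ i, HasDecay d C (kernelPartial Θ K θ i) := by
  obtain ⟨C₀, h₀⟩ := hK.decay [] (by simp)
  choose C₁ h₁ using fun i : Fin p => hK.decay [i] (by simp)
  obtain ⟨C, hC⟩ := (Set.finite_range C₁).bddAbove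
  exact ⟨max C₀ C, (show HasDecay d C₀ (K θ) from h₀ θ hθ).mono (le_max_left _ _), fun i =>
    (show HasDecay d (C₁ i) (kernelPartial Θ K θ i) from h₁ i θ hθ).mono
      ((hC ⟨i, rfl⟩).trans (le_max_right _ _))⟩

lemma continuous_dirDeriv (hK : IsRegularModel Θ K) (hΘ : Θ ∈ 𝓝 θ₀) (lam : Fin p → ℝ) :
    Continuous (dirDeriv Θ K θ₀ lam) :=
  continuous_finsetSum _ fun i _ => continuous_const.mul (hK.continuous_kernelPartial hΘ i)

lemma ae_restrict_dirDeriv_eq_zero (hK : IsRegularModel Θ K) (hΘ : Θ ∈ 𝓝 θ₀) {lam : Fin p → ℝ}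
    {D : Set (EuclideanSpace ℝ (Fin d))} (hD : ∀ t ∈ D, dirDeriv Θ K θ₀ lam t = 0) :
    ∀ᵐ t ∂volume.restrict D, dirDeriv Θ K θ₀ lam t = 0 :=
  (ae_restrict_iff (isClosed_singleton.preimage (hK.continuous_dirDeriv hΘ lam)).measurableSet).2
    (ae_of_all _ hD)

end IsRegularModel

section CovarianceMatrix

variable (Θ K) (v : ℕ → Fin d → ℤ) (ε : ℝ) (x : ℕ → EuclideanSpace ℝ (Fin d)) (n : ℕ)
  (θ : Fin p → ℝ)

lemma covMatrix_eq_kernelMatrix :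
    covMatrix K v ε x n θ = kernelMatrix (K θ) (perturbedGrid v ε x n) := by
  ext i j
  rw [kernelMatrix_apply, perturbedGrid, perturbedLattice, perturbedLattice, add_sub_add_comm,
    ← smul_sub]
  rfl

lemma covMatrixDeriv_eq_kernelMatrix (i : Fin p) :
    covMatrixDeriv Θ K v ε x n θ i =
      kernelMatrix (kernelPartial Θ K θ i) (perturbedGrid v ε x n) := by
  simp only [covMatrixDeriv, covMatrix_eq_kernelMatrix]
  rfl

lemma trace_matrixML (i j : Fin p) : (matrixML Θ K v ε x n θ i j).trace =
    (kernelSandwich (K θ) (kernelPartial Θ K θ i) (kernelPartial Θ K θ j)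
      (perturbedGrid v ε x n)).trace / 2 := by
  rw [matrixML, covMatrix_eq_kernelMatrix, covMatrixDeriv_eq_kernelMatrix,
    covMatrixDeriv_eq_kernelMatrix, Matrix.trace_smul, smul_eq_mul, one_div_mul_eq_div]
  rfl

end CovarianceMatrix

end Model

/-! ### Almost sure limits of normalized traces -/

section BoxEmbedding

variable {d ρ n : ℕ} {v : ℕ → Fin d → ℤ} {i : Fin n} {e : latticeBox d ρ → Fin n}

/-- The map `e` sends the sites of the cube of radius `ρ` to the indices of their translates around
the site with index `i`. -/
def IsBoxEmbedding (v : ℕ → Fin d → ℤ) (i : Fin n) (e : latticeBox d ρ → Fin n) : Prop :=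
  ∀ w, v (e w) = v i + w

/-- The centre of the cube of radius `ρ`. -/
noncomputable def boxCentre (d ρ : ℕ) : latticeBox d ρ :=
  ⟨0, mem_latticeBox.2 (by simp)⟩

lemma exists_isBoxEmbedding (hb : (i : ℕ) ∉ boundaryIndices v ρ n) :
    ∃ e : latticeBox d ρ → Fin n, IsBoxEmbedding v i e := by
  choose j hjn hj using fun w : latticeBox d ρ =>
    exists_apply_eq_add_of_notMem_boundaryIndices i.2 hb w.2
  exact ⟨fun w => ⟨j w, hjn w⟩, hj⟩

namespace IsBoxEmbedding

lemma injective (he : IsBoxEmbedding v i e) : e.Injective := fun w w' h =>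
  Subtype.ext (add_left_cancel ((he w).symm.trans (by rw [h, he w'])))

lemma apply_boxCentre (he : IsBoxEmbedding v i e) (hv : v.Injective) : e (boxCentre d ρ) = i :=
  Fin.ext (hv ((he _).trans (add_zero _)))

lemma neighbourIndex_eq (he : IsBoxEmbedding v i e) (hv : v.Injective) (w : latticeBox d ρ) :
    neighbourIndex v i w = e w :=
  PerturbedGrid.neighbourIndex_eq hv (he w)

lemma le_norm_sub_of_notMem_range (he : IsBoxEmbedding v i e) (hv : v.Injective) {j : Fin n}
    (hj : j ∉ Set.range e) : (ρ : ℝ) ≤ ‖v j - v i‖ := by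
  contrapose! hj
  refine ⟨⟨v j - v i, mem_latticeBox.2 hj.le⟩, Fin.ext (hv ?_)⟩
  rw [he, add_sub_cancel]

lemma kernelMatrix_perturbedGrid_comp (he : IsBoxEmbedding v i e) (hv : v.Injective)
    (k : EuclideanSpace ℝ (Fin d) → ℝ) (ε : ℝ) (x : ℕ → EuclideanSpace ℝ (Fin d)) :
    kernelMatrix k (perturbedGrid v ε x n ∘ e) =
      kernelMatrix k (perturbedLattice ε (Subtype.val : latticeBox d ρ → Fin d → ℤ)
        fun w => x (neighbourIndex v i w)) := by
  rw [← kernelMatrix_perturbedLattice_add k ε (v i)]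
  congr 1
  funext w
  simp only [Function.comp_apply, perturbedGrid, perturbedLattice, he w, he.neighbourIndex_eq hv]

end IsBoxEmbedding

end BoxEmbedding

section Trace

variable {d : ℕ} {v : ℕ → Fin d → ℤ} {ε c C : ℝ} {k kA kB : EuclideanSpace ℝ (Fin d) → ℝ}

/-- The central diagonal entry of `R⁻¹ A R⁻¹ B` for the lattice points of the cube of radius `ρ`,
displaced by `ε • z`: the local approximation of the diagonal entries on a large grid. -/
noncomputable def centralEntry (k kA kB : EuclideanSpace ℝ (Fin d) → ℝ) (ε : ℝ) (ρ : ℕ)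
    (z : latticeBox d ρ → EuclideanSpace ℝ (Fin d)) : ℝ :=
  kernelSandwich k kA kB (perturbedLattice ε Subtype.val z) (boxCentre d ρ) (boxCentre d ρ)

lemma measurable_centralEntry (hk : Continuous k) (hA : Continuous kA) (hB : Continuous kB)
    (ε : ℝ) (ρ : ℕ) : Measurable (centralEntry k kA kB ε ρ) :=
  measurable_kernelSandwich_apply hk hA hB (continuous_perturbedLattice ε _) _ _

lemma abs_centralEntry_le (hε : |ε| < 1 / 2) (hc : 0 < c)
    (hcoer : IsUniformlyCoercive d (1 - 2 * |ε|) c k) (hA : HasDecay d C kA)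
    (hB : HasDecay d C kB) {ρ : ℕ} {z : latticeBox d ρ → EuclideanSpace ℝ (Fin d)}
    (hz : ∀ w, z w ∈ unitCube d) : |centralEntry k kA kB ε ρ z| ≤
      sandwichBound c (∑' w, latticeMajorant d (1 - 2 * |ε|) C w) :=
  have hsep := isSeparated_perturbedLattice Subtype.val_injective hz ε
  abs_kernelSandwich_apply_le hc (hcoer _ _ _ hsep) (by linarith) hA hB hsep _

lemma abs_kernelSandwich_perturbedGrid_sub_le (hv : v.Injective) (hε : |ε| < 1 / 2) (hc : 0 < c)
    (hcoer : IsUniformlyCoercive d (1 - 2 * |ε|) c k) (hk : HasDecay d C k)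
    (hA : HasDecay d C kA) (hB : HasDecay d C kB) {x : ℕ → EuclideanSpace ℝ (Fin d)}
    (hx : ∀ i, x i ∈ unitCube d) {ρ n : ℕ} (hρ : 0 < ρ) {i : Fin n}
    (hi : (i : ℕ) ∉ boundaryIndices v ρ n) :
    |kernelSandwich k kA kB (perturbedGrid v ε x n) i i -
      centralEntry k kA kB ε ρ fun w => x (neighbourIndex v i w)| ≤
        localityError d (1 - 2 * |ε|) c C ρ := by
  obtain ⟨e, he⟩ := exists_isBoxEmbedding hi
  have hsep := isSeparated_perturbedGrid hv hx ε n
  have h := abs_kernelSandwich_apply_sub_le hc (hcoer _ _ _ hsep) (by linarith) hk hA hB hsep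
    (Nat.cast_pos.2 hρ) he.injective (l := boxCentre d ρ) fun j hj => by
      rw [he.apply_boxCentre hv]
      exact he.le_norm_sub_of_notMem_range hv hj
  rwa [kernelSandwich, kernelSandwich, he.kernelMatrix_perturbedGrid_comp hv,
    he.kernelMatrix_perturbedGrid_comp hv, he.kernelMatrix_perturbedGrid_comp hv,
    he.apply_boxCentre hv] at h

variable {Ω : Type*} [MeasurableSpace Ω] {P : Measure Ω} {L : Measure (EuclideanSpace ℝ (Fin d))}
  [IsProbabilityMeasure L] {X : ℕ → Ω → EuclideanSpace ℝ (Fin d)}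

omit [IsProbabilityMeasure L] in
lemma ae_forall_mem_unitCube (hXL : ∀ i, HasLaw (X i) L P) (hL : ∀ᵐ x ∂L, x ∈ unitCube d) :
    ∀ᵐ ω ∂P, ∀ i, X i ω ∈ unitCube d :=
  ae_all_iff.2 fun i => ae_of_ae_map (hXL i).aemeasurable ((hXL i).map_eq ▸ hL)

lemma ae_eventually_abs_trace_sub_le (hd : 0 < d) (hv : IsGridEnumeration v) (hε : |ε| < 1 / 2)
    (hc : 0 < c) (hcoer : IsUniformlyCoercive d (1 - 2 * |ε|) c k) (hkc : Continuous k)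
    (hAc : Continuous kA) (hBc : Continuous kB) (hk : HasDecay d C k) (hA : HasDecay d C kA)
    (hB : HasDecay d C kB) (hX : iIndepFun X P) (hXL : ∀ i, HasLaw (X i) L P)
    (hL : ∀ᵐ x ∂L, x ∈ unitCube d) {ρ : ℕ} (hρ : 0 < ρ) :
    ∀ᵐ ω ∂P, ∀ δ > 0, ∀ᶠ n : ℕ in atTop,
      |(kernelSandwich k kA kB (perturbedGrid v ε (X · ω) n)).trace / n -
        ∫ z, centralEntry k kA kB ε ρ z ∂Measure.pi fun _ => L| ≤
          localityError d (1 - 2 * |ε|) c C ρ + δ := by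
  have hinj := hv.injective hd
  have hδ : 0 < 1 - 2 * |ε| := by linarith
  let b := sandwichBound c (∑' w, latticeMajorant d (1 - 2 * |ε|) C w)
  filter_upwards [ae_forall_mem_unitCube hXL hL, hv.ae_tendsto_average_local hd hX hXL hL
    (measurable_centralEntry hkc hAc hBc ε ρ)
    fun z hz => abs_centralEntry_le hε hc hcoer hA hB hz] with ω hω hlln δ
  have hlocal (i : ℕ) :
      |centralEntry k kA kB ε ρ fun w => X (neighbourIndex v i w) ω| ≤ b :=
    abs_centralEntry_le hε hc hcoer hA hB fun _ => hω _
  have hentry (n : ℕ) (i : Fin n) :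
      |kernelSandwich k kA kB (perturbedGrid v ε (X · ω) n) i i| ≤ b :=
    have hsep := isSeparated_perturbedGrid hinj hω ε n
    abs_kernelSandwich_apply_le hc (hcoer _ _ _ hsep) hδ hA hB hsep i
  exact eventually_abs_average_sub_le (B := b + b)
    (t := fun n i => kernelSandwich k kA kB (perturbedGrid v ε (X · ω) n) i i)
    (Z := fun i => centralEntry k kA kB ε ρ fun w => X (neighbourIndex v i w) ω)
    (hv.tendsto_card_boundaryIndices hd ρ) hlln
    (localityError_nonneg hδ.le hc.le hk.nonneg ρ.cast_nonneg)
    (add_nonneg ((abs_nonneg _).trans (hlocal 0)) ((abs_nonneg _).trans (hlocal 0)))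
    (fun n i hi => abs_kernelSandwich_perturbedGrid_sub_le hinj hε hc hcoer hk hA hB hω hρ hi)
    fun n i => (abs_sub _ _).trans (add_le_add (hentry n i) (hlocal i))

theorem exists_ae_tendsto_trace (hd : 0 < d) (hv : IsGridEnumeration v) (hε : |ε| < 1 / 2)
    (hc : 0 < c) (hcoer : IsUniformlyCoercive d (1 - 2 * |ε|) c k) (hkc : Continuous k)
    (hAc : Continuous kA) (hBc : Continuous kB) (hk : HasDecay d C k) (hA : HasDecay d C kA)
    (hB : HasDecay d C kB) (hX : iIndepFun X P) (hXL : ∀ i, HasLaw (X i) L P)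
    (hL : ∀ᵐ x ∂L, x ∈ unitCube d) :
    ∃ s, ∀ᵐ ω ∂P, Tendsto (fun n : ℕ =>
      (kernelSandwich k kA kB (perturbedGrid v ε (X · ω) n)).trace / n) atTop (𝓝 s) := by
  have := (hXL 0).isProbabilityMeasure
  have hη : Tendsto (fun ρ : ℕ => localityError d (1 - 2 * |ε|) c C ((ρ + 1 : ℕ) : ℝ)) atTop
      (𝓝 0) :=
    (tendsto_localityError (by linarith) hk.nonneg).comp
      (tendsto_natCast_atTop_atTop.comp (tendsto_add_atTop_nat 1))
  have happrox := ae_all_iff.2 fun ρ : ℕ => ae_eventually_abs_trace_sub_le hd hv hε hc hcoer hkc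
    hAc hBc hk hA hB hX hXL hL ρ.succ_pos
  obtain ⟨ω₀, hω₀⟩ := happrox.exists
  obtain ⟨s, hs⟩ := cauchySeq_tendsto_of_complete (cauchySeq_of_eventually_abs_sub_le hη hω₀)
  exact ⟨s, happrox.mono fun ω hω => tendsto_of_eventually_abs_sub_le hη hs hω⟩

end Trace

/-! ### Positive definiteness of the limit -/

section Lags

variable {d : ℕ} {S : Set (EuclideanSpace ℝ (Fin d))} {ε : ℝ} {t : EuclideanSpace ℝ (Fin d)}

lemma exists_eq_of_mem_insert_lagSet (hS : S.Nonempty) (ht : t ∈ insert 0 (lagSet S ε)) :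
    ∃ w : Fin d → ℤ, ∃ t₁ ∈ S, ∃ t₂ ∈ S, (w = 0 → t₁ = t₂) ∧
      t = latticePoint w + ε • (t₁ - t₂) := by
  rcases ht with rfl | ⟨w, hw, t₁, h₁, t₂, h₂, ht⟩
  · obtain ⟨s, hs⟩ := hS
    exact ⟨0, s, hs, s, hs, fun _ => rfl, by rw [latticePoint_zero, sub_self, smul_zero, add_zero]⟩
  · exact ⟨w, t₁, h₁, t₂, h₂, fun h => absurd h hw, ht⟩

lemma latticePoint_mem_insert_lagSet_zero (hS : S.Nonempty) (w : Fin d → ℤ) :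
    latticePoint w ∈ insert 0 (lagSet S 0) := by
  rcases eq_or_ne w 0 with rfl | hw
  · exact .inl latticePoint_zero
  · obtain ⟨s, hs⟩ := hS
    exact .inr ⟨w, hw, s, hs, s, hs, by rw [zero_smul, add_zero]⟩

end Lags

section LowerBound

lemma integral_pi_pos_of_mem_support {κ 𝓧 : Type*} [Fintype κ] [TopologicalSpace 𝓧]
    [MeasurableSpace 𝓧] {L : Measure 𝓧} [SigmaFinite L] {ψ : (κ → 𝓧) → ℝ} (hψ : Continuous ψ)
    (hψ₀ : ∀ z, 0 ≤ ψ z) (hint : Integrable ψ (Measure.pi fun _ => L)) {a : κ → 𝓧}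
    (ha : ∀ w, a w ∈ L.support) (hψa : ψ a ≠ 0) : 0 < ∫ z, ψ z ∂Measure.pi fun _ => L := by
  rw [integral_pos_iff_support_of_nonneg hψ₀ hint]
  obtain ⟨u, hu, hsub⟩ := isOpen_pi_iff'.1 hψ.isOpen_support a hψa
  refine lt_of_lt_of_le ?_ (measure_mono hsub)
  rw [Measure.pi_pi, CanonicallyOrderedAdd.prod_pos]
  exact fun w _ => (Measure.mem_support_iff_forall _).1 (ha w) _ ((hu w).1.mem_nhds (hu w).2)

variable {d ρ : ℕ} {v : ℕ → Fin d → ℤ} {ε C : ℝ} {k : EuclideanSpace ℝ (Fin d) → ℝ}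

/-- The square of the entry with row `0` and column `w` of the matrix of the kernel `k` at the
lattice points of the cube of radius `ρ`, displaced by `ε • z`: a local lower bound for the
squared norms of the rows on a large grid. -/
noncomputable def centralSqEntry (k : EuclideanSpace ℝ (Fin d) → ℝ) (ε : ℝ) (w : latticeBox d ρ)
    (z : latticeBox d ρ → EuclideanSpace ℝ (Fin d)) : ℝ :=
  kernelMatrix k (perturbedLattice ε Subtype.val z) (boxCentre d ρ) w ^ 2

lemma centralSqEntry_nonneg (k : EuclideanSpace ℝ (Fin d) → ℝ) (ε : ℝ) (w : latticeBox d ρ)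
    (z : latticeBox d ρ → EuclideanSpace ℝ (Fin d)) : 0 ≤ centralSqEntry k ε w z :=
  sq_nonneg _

lemma abs_centralSqEntry_le (hk : ∀ t, |k t| ≤ C) (ε : ℝ) (w : latticeBox d ρ)
    (z : latticeBox d ρ → EuclideanSpace ℝ (Fin d)) : |centralSqEntry k ε w z| ≤ C ^ 2 := by
  rw [centralSqEntry, abs_pow]
  exact pow_le_pow_left₀ (abs_nonneg _) (hk _) 2

lemma continuous_centralSqEntry (hk : Continuous k) (ε : ℝ) (w : latticeBox d ρ) :
    Continuous (centralSqEntry k ε w) :=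
  ((continuous_kernelMatrix hk (continuous_perturbedLattice ε _)).matrix_elem _ _).pow 2

lemma centralSqEntry_le_sum_sq (hv : v.Injective) (k : EuclideanSpace ℝ (Fin d) → ℝ) (ε : ℝ)
    (x : ℕ → EuclideanSpace ℝ (Fin d)) (w : latticeBox d ρ) {n : ℕ} {i : Fin n}
    (hi : (i : ℕ) ∉ boundaryIndices v ρ n) :
    (centralSqEntry k ε w fun w' => x (neighbourIndex v i w')) ≤
      ∑ j, kernelMatrix k (perturbedGrid v ε x n) i j ^ 2 := by
  obtain ⟨e, he⟩ := exists_isBoxEmbedding hi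
  rw [centralSqEntry, ← he.kernelMatrix_perturbedGrid_comp hv]
  change kernelMatrix k (perturbedGrid v ε x n) (e (boxCentre d ρ)) (e w) ^ 2 ≤ _
  rw [he.apply_boxCentre hv]
  exact Finset.single_le_sum
    (f := fun j => kernelMatrix k (perturbedGrid v ε x n) i j ^ 2)
    (fun j _ => sq_nonneg _) (Finset.mem_univ (e w))

variable {L : Measure (EuclideanSpace ℝ (Fin d))} [IsProbabilityMeasure L]

lemma exists_integral_centralSqEntry_pos (hkc : Continuous k) (hk : ∀ t, |k t| ≤ C)
    {t : EuclideanSpace ℝ (Fin d)} (ht : t ∈ insert 0 (lagSet L.support ε)) (hkt : k t ≠ 0) :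
    ∃ ρ, ∃ w : latticeBox d ρ, 0 < ∫ z, centralSqEntry k ε w z ∂Measure.pi fun _ => L := by
  classical
  obtain ⟨w, t₁, h₁, t₂, h₂, hw, rfl⟩ := exists_eq_of_mem_insert_lagSet
    (Measure.nonempty_support (IsProbabilityMeasure.ne_zero L)) ht
  let w' : latticeBox d ⌈‖w‖⌉₊ := ⟨-w, mem_latticeBox.2 ((norm_neg w).trans_le (Nat.le_ceil _))⟩
  have hcont := continuous_centralSqEntry hkc ε w'
  refine ⟨_, w', integral_pi_pos_of_mem_support hcont (centralSqEntry_nonneg k ε w')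
    (.of_bound hcont.aestronglyMeasurable (C ^ 2) (ae_of_all _ (abs_centralSqEntry_le hk ε w')))
    (a := fun u => if u = boxCentre d _ then t₁ else t₂) (fun u => ?_) (pow_ne_zero 2 ?_)⟩
  · split_ifs
    exacts [h₁, h₂]
  · have h : (if w' = boxCentre d _ then t₁ else t₂) = t₂ :=
      ite_eq_right_iff.2 fun h => hw (neg_eq_zero.1 (congrArg Subtype.val h))
    rw [kernelMatrix_apply, perturbedLattice_sub, if_pos rfl, h]
    simpa [w', boxCentre] using hkt

theorem exists_ae_eventually_le_sum_sq {Ω : Type*} [MeasurableSpace Ω] {P : Measure Ω}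
    {X : ℕ → Ω → EuclideanSpace ℝ (Fin d)} (hd : 0 < d) (hv : IsGridEnumeration v)
    (hX : iIndepFun X P) (hXL : ∀ i, HasLaw (X i) L P) (hkc : Continuous k)
    (hk : ∀ t, |k t| ≤ C) {t : EuclideanSpace ℝ (Fin d)}
    (ht : t ∈ insert 0 (lagSet L.support ε)) (hkt : k t ≠ 0) :
    ∃ m > 0, ∀ᵐ ω ∂P, ∀ᶠ n : ℕ in atTop,
      m ≤ (∑ i, ∑ j, kernelMatrix k (perturbedGrid v ε (X · ω) n) i j ^ 2) / n := by
  obtain ⟨ρ, w, hpos⟩ := exists_integral_centralSqEntry_pos hkc hk ht hkt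
  refine ⟨_, half_pos hpos, ?_⟩
  filter_upwards [hv.ae_tendsto_average_local hd hX hXL (S := Set.univ) (ae_of_all _ Set.mem_univ)
    (continuous_centralSqEntry hkc ε w).measurable fun z _ => abs_centralSqEntry_le hk ε w z]
    with ω hω
  filter_upwards [eventually_le_average
    (t := fun n i => ∑ j, kernelMatrix k (perturbedGrid v ε (X · ω) n) i j ^ 2)
    (Z := fun i => centralSqEntry k ε w fun w' => X (neighbourIndex v i w') ω)
    (hv.tendsto_card_boundaryIndices hd ρ) hω le_rfl (sq_nonneg C)
    (fun n i hi => sub_nonpos.2 (centralSqEntry_le_sum_sq (hv.injective hd) k ε (X · ω) w hi))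
    (fun n i => (sub_le_self _ (Finset.sum_nonneg fun j _ => sq_nonneg _)).trans
      ((le_abs_self _).trans (abs_centralSqEntry_le hk ε w _))) (half_pos hpos)] with n hn
  linarith

end LowerBound

section PositiveDefinite

variable {d : ℕ} {q : Type*} [Fintype q] {ε c C δ : ℝ} {k kA : EuclideanSpace ℝ (Fin d) → ℝ}
  {kD : q → EuclideanSpace ℝ (Fin d) → ℝ}

/-- A positive lower bound for the ratio of `Tr (R⁻¹ A R⁻¹ A)` to the squared Frobenius norm of `A`,
when the matrix `R` comes from a kernel bounded by `C / (1 + ‖t‖ ^ (d + 1))` at a `δ`-separated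
configuration and `c • 1 ≤ R`. -/
noncomputable def traceLowerConst (d : ℕ) (δ c C : ℝ) : ℝ :=
  (c / max (∑' w, latticeMajorant d δ C w) 1 ^ 2) ^ 2

lemma traceLowerConst_pos (hc : 0 < c) : 0 < traceLowerConst d δ c C := by
  have : 0 < max (∑' w, latticeMajorant d δ C w) 1 := lt_max_of_lt_right one_pos
  rw [traceLowerConst]
  positivity

lemma traceLowerConst_mul_sum_sq_le {ι : Type*} [Fintype ι] [DecidableEq ι] {u : ι → Fin d → ℤ}
    {y : ι → EuclideanSpace ℝ (Fin d)} (hc : 0 < c) (hcoer : c • 1 ≤ kernelMatrix k y) (hδ : 0 < δ)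
    (hk : HasDecay d C k) (hA : ∀ t, kA (-t) = kA t) (hy : IsSeparated δ u y) :
    traceLowerConst d δ c C * ∑ i, ∑ j, kernelMatrix kA y i j ^ 2 ≤
      (kernelSandwich k kA kA y).trace :=
  mul_sum_sq_le_trace hc hcoer ((hk.norm_kernelMatrix_le hδ hy).trans (le_max_left _ 1))
    (isHermitian_kernelMatrix hA y)

lemma trace_kernelSandwich_sum {ι : Type*} [Fintype ι] [DecidableEq ι]
    (k : EuclideanSpace ℝ (Fin d) → ℝ) (kD : q → EuclideanSpace ℝ (Fin d) → ℝ) (lam : q → ℝ)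
    (y : ι → EuclideanSpace ℝ (Fin d)) :
    (kernelSandwich k (fun t => ∑ i, lam i * kD i t) (fun t => ∑ i, lam i * kD i t) y).trace =
      ∑ i, ∑ j, lam i * lam j * (kernelSandwich k (kD i) (kD j) y).trace := by
  have hsum : kernelMatrix (fun t => ∑ i, lam i * kD i t) y =
      ∑ i, lam i • kernelMatrix (kD i) y := by
    ext a b
    simp only [kernelMatrix_apply, Matrix.sum_apply, Matrix.smul_apply, smul_eq_mul]
  rw [kernelSandwich, hsum, trace_sandwich_sum]
  rfl

variable {v : ℕ → Fin d → ℤ} {Ω : Type*} [MeasurableSpace Ω] {P : Measure Ω}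
  {L : Measure (EuclideanSpace ℝ (Fin d))} [IsProbabilityMeasure L]
  {X : ℕ → Ω → EuclideanSpace ℝ (Fin d)}

lemma pos_of_ae_tendsto_trace (hd : 0 < d) (hv : IsGridEnumeration v) (hε : |ε| < 1 / 2)
    (hc : 0 < c) (hcoer : IsUniformlyCoercive d (1 - 2 * |ε|) c k) (hk : HasDecay d C k)
    (hAc : Continuous kA) {B : ℝ} (hAB : ∀ t, |kA t| ≤ B) (hAneg : ∀ t, kA (-t) = kA t)
    (hX : iIndepFun X P) (hXL : ∀ i, HasLaw (X i) L P) (hL : ∀ᵐ x ∂L, x ∈ unitCube d)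
    {t : EuclideanSpace ℝ (Fin d)} (ht : t ∈ insert 0 (lagSet L.support ε)) (hAt : kA t ≠ 0)
    {s : ℝ} (hs : ∀ᵐ ω ∂P, Tendsto (fun n : ℕ =>
      (kernelSandwich k kA kA (perturbedGrid v ε (X · ω) n)).trace / n) atTop (𝓝 s)) : 0 < s := by
  have := (hXL 0).isProbabilityMeasure
  have hκ : 0 < traceLowerConst d (1 - 2 * |ε|) c C := traceLowerConst_pos hc
  obtain ⟨m, hm, hsum⟩ := exists_ae_eventually_le_sum_sq hd hv hX hXL hAc hAB ht hAt
  obtain ⟨ω, hω, hlim, hsumω⟩ := ((ae_forall_mem_unitCube hXL hL).and (hs.and hsum)).exists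
  refine (mul_pos hκ hm).trans_le (ge_of_tendsto hlim ?_)
  filter_upwards [hsumω] with n hn
  have hsep := isSeparated_perturbedGrid (hv.injective hd) hω ε n
  refine (mul_le_mul_of_nonneg_left hn hκ.le).trans ?_
  rw [← mul_div_assoc]
  exact div_le_div_of_nonneg_right (traceLowerConst_mul_sum_sq_le hc (hcoer _ _ _ hsep)
    (by linarith) hk hAneg hsep) n.cast_nonneg

omit [IsProbabilityMeasure L] in
lemma ae_tendsto_trace_sum {s : q → q → ℝ}
    (hs : ∀ i j, ∀ᵐ ω ∂P, Tendsto (fun n : ℕ =>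
      (kernelSandwich k (kD i) (kD j) (perturbedGrid v ε (X · ω) n)).trace / n) atTop (𝓝 (s i j)))
    (lam : q → ℝ) :
    ∀ᵐ ω ∂P, Tendsto (fun n : ℕ => (kernelSandwich k (fun t => ∑ i, lam i * kD i t)
      (fun t => ∑ i, lam i * kD i t) (perturbedGrid v ε (X · ω) n)).trace / n) atTop
        (𝓝 (∑ i, ∑ j, lam i * lam j * s i j)) := by
  filter_upwards [ae_all_iff.2 fun i => ae_all_iff.2 (hs i)] with ω hω
  simp only [trace_kernelSandwich_sum, Finset.sum_div, mul_div_assoc]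
  exact tendsto_finsetSum _ fun i _ => tendsto_finsetSum _ fun j _ => (hω i j).const_mul _

theorem exists_posDef_ae_tendsto_trace (hd : 0 < d) (hv : IsGridEnumeration v) (hε : |ε| < 1 / 2)
    (hc : 0 < c) (hcoer : IsUniformlyCoercive d (1 - 2 * |ε|) c k) (hkc : Continuous k)
    (hDc : ∀ i, Continuous (kD i)) (hk : HasDecay d C k) (hD : ∀ i, HasDecay d C (kD i))
    (hDneg : ∀ i t, kD i (-t) = kD i t) (hX : iIndepFun X P) (hXL : ∀ i, HasLaw (X i) L P)
    (hL : ∀ᵐ x ∂L, x ∈ unitCube d)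
    (hdet : ∀ lam : q → ℝ,
      (∀ t ∈ insert 0 (lagSet L.support ε), ∑ i, lam i * kD i t = 0) → lam = 0) :
    ∃ S : Matrix q q ℝ, S.PosDef ∧ ∀ i j, ∀ᵐ ω ∂P, Tendsto (fun n : ℕ =>
      (kernelSandwich k (kD i) (kD j) (perturbedGrid v ε (X · ω) n)).trace / n) atTop
        (𝓝 (S i j)) := by
  have := (hXL 0).isProbabilityMeasure
  choose s hs using fun i j => exists_ae_tendsto_trace hd hv hε hc hcoer hkc (hDc i) (hDc j) hk
    (hD i) (hD j) hX hXL hL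
  refine ⟨.of s, .of_dotProduct_mulVec_pos ?_ fun lam hlam => ?_, hs⟩
  · ext i j
    obtain ⟨ω, hij, hji⟩ := ((hs i j).and (hs j i)).exists
    exact tendsto_nhds_unique hji
      (by simpa only [kernelSandwich, trace_sandwich_comm, of_apply] using hij)
  obtain ⟨t, ht, hlamt⟩ : ∃ t ∈ insert 0 (lagSet L.support ε), ∑ i, lam i * kD i t ≠ 0 := by
    contrapose! hlam
    exact hdet lam hlam
  have hbound (t : EuclideanSpace ℝ (Fin d)) : |∑ i, lam i * kD i t| ≤ ∑ i, |lam i| * C := by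
    refine (Finset.abs_sum_le_sum_abs _ _).trans (Finset.sum_le_sum fun i _ => ?_)
    rw [abs_mul]
    exact mul_le_mul_of_nonneg_left ((hD i).abs_le t) (abs_nonneg _)
  have hquad : star lam ⬝ᵥ Matrix.of s *ᵥ lam = ∑ i, ∑ j, lam i * lam j * s i j := by
    simp only [star_trivial, dotProduct, mulVec, of_apply, Finset.mul_sum, mul_assoc,
      mul_comm (s _ _)]
  rw [hquad]
  exact pos_of_ae_tendsto_trace (kA := fun t => ∑ i, lam i * kD i t) hd hv hε hc hcoer hk
    (continuous_finsetSum _ fun i _ => continuous_const.mul (hDc i)) hbound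
    (fun t => by simp only [hDneg]) hX hXL hL ht hlamt (ae_tendsto_trace_sum hs lam)

end PositiveDefinite

end PerturbedGrid

open PerturbedGrid MeasureTheory ProbabilityTheory Filter Topology in
theorem mainTheorem6_general {d p : ℕ} (hd : 0 < d) {Θ : Set (Fin p → ℝ)}
    {K : (Fin p → ℝ) → EuclideanSpace ℝ (Fin d) → ℝ} (hK : IsRegularModel Θ K)
    {θ₀ : Fin p → ℝ} (hΘ : Θ ∈ 𝓝 θ₀) {v : ℕ → Fin d → ℤ} (hv : IsGridEnumeration v)
    {ε : ℝ} (hε : |ε| < 1 / 2) {L : Measure (EuclideanSpace ℝ (Fin d))} [IsProbabilityMeasure L]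
    (hL : L.support ⊆ unitCube d) {Ω : Type*} [MeasurableSpace Ω] {P : Measure Ω}
    {X : ℕ → Ω → EuclideanSpace ℝ (Fin d)} (hX : iIndepFun X P) (hXL : ∀ i, HasLaw (X i) L P)
    (hdet : ∀ lam : Fin p → ℝ,
      (∀ t ∈ insert 0 (lagSet L.support ε), dirDeriv Θ K θ₀ lam t = 0) → lam = 0) :
    ∃ S : Matrix (Fin p) (Fin p) ℝ, IsSigmaML Θ K v ε P X θ₀ S ∧ S.PosDef := by
  have hθ₀ := mem_of_mem_nhds hΘ
  obtain ⟨c, hc, hcoer⟩ := hK.exists_isUniformlyCoercive hθ₀ (δ := 1 - 2 * |ε|) (by linarith)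
  obtain ⟨C, hk, hD⟩ := hK.exists_hasDecay hθ₀
  obtain ⟨S, hS, hlim⟩ := exists_posDef_ae_tendsto_trace hd hv hε hc hcoer (hK.continuous hθ₀)
    (hK.continuous_kernelPartial hΘ) hk hD (hK.kernelPartial_neg hθ₀) hX hXL
    (mem_of_superset Measure.support_mem_ae hL) hdet
  refine ⟨(1 / 2 : ℝ) • S, fun i j => ?_, hS.smul one_half_pos⟩
  filter_upwards [hlim i j] with ω hω
  simpa only [trace_matrixML, Matrix.smul_apply, smul_eq_mul, one_div_mul_eq_div,
    div_right_comm _ (2 : ℝ)] using hω.div_const 2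

theorem mainTheorem6 {d p : ℕ} (hd : 0 < d) (θinf θsup : ℝ)
    (K : (Fin p → ℝ) → EuclideanSpace ℝ (Fin d) → ℝ)
    (hK : PerturbedGrid.IsRegularModel (PerturbedGrid.paramBox p θinf θsup) K)
    (θ₀ : Fin p → ℝ) (hθ₀ : ∀ i, θinf < θ₀ i ∧ θ₀ i < θsup)
    (v : ℕ → Fin d → ℤ) (hv : PerturbedGrid.IsGridEnumeration v)
    (ε : ℝ) (hε₀ : 0 ≤ ε) (hε : ε < 1 / 2)
    (L : MeasureTheory.Measure (EuclideanSpace ℝ (Fin d))) (hL : PerturbedGrid.IsPerturbationLaw L)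
    {Ω : Type*} [MeasurableSpace Ω] (P : MeasureTheory.Measure Ω)
    [MeasureTheory.IsProbabilityMeasure P] (X : ℕ → Ω → EuclideanSpace ℝ (Fin d))
    (hX : ProbabilityTheory.iIndepFun X P) (hXL : ∀ i, ProbabilityTheory.HasLaw (X i) L P) :
    (ε = 0 →
      (¬ ∃ lam : Fin p → ℝ, lam ≠ 0 ∧ ∀ w : Fin d → ℤ,
        PerturbedGrid.dirDeriv (PerturbedGrid.paramBox p θinf θsup) K θ₀ lam
          (PerturbedGrid.latticePoint w) = 0) →
      ∃ S : Matrix (Fin p) (Fin p) ℝ,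
        PerturbedGrid.IsSigmaML (PerturbedGrid.paramBox p θinf θsup) K v ε P X θ₀ S ∧ S.PosDef) ∧
    (ε ≠ 0 →
      (¬ ∃ lam : Fin p → ℝ, lam ≠ 0 ∧
        (∀ᵐ t ∂(MeasureTheory.volume.restrict (PerturbedGrid.lagSet L.support ε)),
          PerturbedGrid.dirDeriv (PerturbedGrid.paramBox p θinf θsup) K θ₀ lam t = 0) ∧
        PerturbedGrid.dirDeriv (PerturbedGrid.paramBox p θinf θsup) K θ₀ lam 0 = 0) →
      ∃ S : Matrix (Fin p) (Fin p) ℝ,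
        PerturbedGrid.IsSigmaML (PerturbedGrid.paramBox p θinf θsup) K v ε P X θ₀ S ∧ S.PosDef) := by
  have := hL.prob
  have hΘ := PerturbedGrid.paramBox_mem_nhds hθ₀
  have hgeneral := mainTheorem6_general hd hK hΘ hv (abs_lt.2 ⟨by linarith, hε⟩)
    (fun x hx k => abs_le.2 (hL.support_subset x hx k)) hX hXL
  have hS := MeasureTheory.Measure.nonempty_support (MeasureTheory.IsProbabilityMeasure.ne_zero L)
  refine ⟨fun hε₀ h => hgeneral fun lam hlam => ?_, fun _ h => hgeneral fun lam hlam => ?_⟩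
  · subst hε₀
    by_contra hne
    exact h ⟨lam, hne, fun w =>
      hlam _ (PerturbedGrid.latticePoint_mem_insert_lagSet_zero hS w)⟩
  · by_contra hne
    exact h ⟨lam, hne, hK.ae_restrict_dirDeriv_eq_zero hΘ fun t ht => hlam t (.inr ht),
      hlam 0 (.inl rfl)⟩
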